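/- **Setting.** A reversible circuit $C$ on $N\ge1$ bits is a list of NOT gates, each controlled by any set of other wires ($X$, CNOT and Toffoli being the cases of $0,1,2$ controls); it computes a permutation $w\mapsto C(w)$ of $\{0,1\}^N$. The HC1Q circuit of $C$ starts from $|0^N\rangle$, applies $H^{\otimes(N-1)}\otimes I$, then $C$ coherently ($|w\rangle\mapsto|C(w)\rangle$), then $H^{\otimes(N-1)}\otimes I$ again, and measures in the computational basis. For a set $M$ of qubits and $z\in\{0,1\}^M$, let $$p^{C,M}_z=\sum_{w\in\{0,1\}^N,\ w|_M=z}\bigl|\langle w|(H^{\otimes(N-1)}\otimes I)\,C\,(H^{\otimes(N-1)}\otimes I)|0^N\rangle\bigr|^2$$ be the probability of obtaining $z$ when the qubits in $M$ are measured. A family $(C_i)_i$ of reversible circuits, where $C_i$ acts on $N_i\ge1$ bits and is named by a bit string $x_i$ (for instance $x_N=1^N$ and $N_N=N$), is polynomial-time uniformly generated if a single classical algorithm, given $x_i$, outputs a description of $C_i$ (including $N_i$ in unary) in time polynomial in $|x_i|$. **Theorem 3.** Let $(C_i)_i$ be a polynomial-time uniformly generated family of reversible circuits, let $k:\mathbb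 N\to\mathbb N$ satisfy $k(n)=O(\log n)$, and let $r$ be a polynomial with natural number coefficients and $r(n)>0$ for all integers $n\ge1$. Then there are a classical algorithm and polynomials $m,t$ such that, for every $i$ and every set $M$ of at most $k(N_i)$ of the $N_i$ qubits, the algorithm, given $x_i$, $M$ and a uniformly random string of $m(|x_i|+N_i)$ bits, always halts within $t(|x_i|+N_i)$ steps and outputs a string in $\{0,1\}^M$, and the distribution $(q_z)_z$ of its output satisfies $$\sum_{z\in\{0,1\}^M}\bigl|p^{C_i,M}_z-q_z\bigr|\le\frac1{r(N_i)}.$$ -/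

import Mathlib

open Filter Asymptotics

/-! ### A machine model with a step count

A program works on finitely many registers (it mentions only finitely many), each of which holds a
bit string and is accessed as a stack. Every push, pop and test costs one step. This is the
multi-stack Turing machine with its finite control written as a structured program. -/

/-- Programs of the stack machine. -/
inductive Cmd : Type
  | skip : Cmd
  | push (r : ℕ) (b : Bool) : Cmd
  | pop (r : ℕ) : Cmd
  | seq (c d : Cmd) : Cmd
  /-- three-way branch: register `r` is empty, has `false` on top, has `true` on top -/
  | case (r : ℕ) (cNil cFalse cTrue : Cmd) : Cmd
  /-- repeat `c` as long as register `r` is not empty -/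
  | loop (r : ℕ) (c : Cmd) : Cmd

/-- Contents of the registers. -/
abbrev Store : Type := ℕ → List Bool

/-- `Cmd.Exec c s n s'`: started in `s`, the program `c` halts after exactly `n` steps in `s'`. -/
inductive Cmd.Exec : Cmd → Store → ℕ → Store → Prop
  | skip (s : Store) : Cmd.Exec Cmd.skip s 1 s
  | push (s : Store) (r : ℕ) (b : Bool) :
      Cmd.Exec (Cmd.push r b) s 1 (Function.update s r (b :: s r))
  | pop (s : Store) (r : ℕ) :
      Cmd.Exec (Cmd.pop r) s 1 (Function.update s r (s r).tail)
  | seq {c d : Cmd} {s s' s'' : Store} {m n : ℕ} :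
      Cmd.Exec c s m s' → Cmd.Exec d s' n s'' → Cmd.Exec (Cmd.seq c d) s (m + n) s''
  | caseNil {r : ℕ} {c₀ c₁ c₂ : Cmd} {s s' : Store} {n : ℕ} :
      s r = [] → Cmd.Exec c₀ s n s' → Cmd.Exec (Cmd.case r c₀ c₁ c₂) s (n + 1) s'
  | caseFalse {r : ℕ} {c₀ c₁ c₂ : Cmd} {s s' : Store} {n : ℕ} :
      (s r).head? = some false → Cmd.Exec c₁ s n s' →
        Cmd.Exec (Cmd.case r c₀ c₁ c₂) s (n + 1) s'
  | caseTrue {r : ℕ} {c₀ c₁ c₂ : Cmd} {s s' : Store} {n : ℕ} :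
      (s r).head? = some true → Cmd.Exec c₂ s n s' →
        Cmd.Exec (Cmd.case r c₀ c₁ c₂) s (n + 1) s'
  | loopDone {r : ℕ} {c : Cmd} {s : Store} :
      s r = [] → Cmd.Exec (Cmd.loop r c) s 1 s
  | loopStep {r : ℕ} {c : Cmd} {s s' s'' : Store} {m n : ℕ} :
      s r ≠ [] → Cmd.Exec c s m s' → Cmd.Exec (Cmd.loop r c) s' n s'' →
        Cmd.Exec (Cmd.loop r c) s (m + n + 1) s''

/-- Initial store: the inputs are in registers `0, 1, 2, …`; all other registers are empty. -/
def initStore (inputs : List (List Bool)) : Store := fun r => inputs.getD r []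

/-- On the given inputs, `c` halts within `t` steps with `out` in register `0`. -/
def Cmd.OutputsIn (c : Cmd) (inputs : List (List Bool)) (out : List Bool) (t : ℕ) : Prop :=
  ∃ (n : ℕ) (s : Store), n ≤ t ∧ Cmd.Exec c (initStore inputs) n s ∧ s 0 = out

/-! ### Classical reversible circuits -/

/-- A NOT gate on the wire `target` controlled by all wires in `controls`. Zero, one and two
controls give `X`, CNOT and Toffoli. -/
structure Gate (N : ℕ) where
  controls : Finset (Fin N)
  target : Fin N
  target_notMem : target ∉ controls

/-- The action of a gate on bit strings. -/
def Gate.apply {N : ℕ} (g : Gate N) (w : Fin N → Bool) : Fin N → Bool :=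
  if ∀ j ∈ g.controls, w j = true then Function.update w g.target (!w g.target) else w

theorem Gate.apply_involutive {N : ℕ} (g : Gate N) : Function.Involutive g.apply := by
  intro w
  by_cases h : ∀ j ∈ g.controls, w j = true
  · have h' : ∀ j ∈ g.controls, Function.update w g.target (!w g.target) j = true := by
      intro j hj
      have hne : j ≠ g.target := fun e => g.target_notMem (e ▸ hj)
      rw [Function.update_of_ne hne]
      exact h j hj
    have e : g.apply w = Function.update w g.target (!w g.target) := if_pos h
    rw [e, Gate.apply, if_pos h']
    simp
  · have e : g.apply w = w := if_neg h
    rw [e, e]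

/-- The permutation of `{0,1}^N` computed by a gate. -/
def Gate.perm {N : ℕ} (g : Gate N) : Equiv.Perm (Fin N → Bool) :=
  g.apply_involutive.toPerm

/-- A reversible circuit on `N` bits: its gates in the order in which they are applied. -/
abbrev RevCircuit (N : ℕ) : Type := List (Gate N)

/-- The permutation `w ↦ C(w)` of `{0,1}^N` computed by a circuit. -/
def RevCircuit.perm {N : ℕ} : RevCircuit N → Equiv.Perm (Fin N → Bool)
  | [] => Equiv.refl _
  | g :: C => g.perm.trans (RevCircuit.perm C)

/-- Two bits for every wire: is it a control, is it the target. -/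
def Gate.encode {N : ℕ} (g : Gate N) : List Bool :=
  (List.finRange N).flatMap fun i => [decide (i ∈ g.controls), decide (i = g.target)]

/-- Description of a circuit: the number of wires in unary, a separator, and the gates. -/
def RevCircuit.encode {N : ℕ} (C : RevCircuit N) : List Bool :=
  List.replicate N true ++ false :: C.flatMap Gate.encode

/-- The family `(C i)` of circuits, whose member `i` is named by the bit string `code i`, is
polynomial-time uniformly generated: one program outputs the description of `C i` on input
`code i`, in time polynomial in the length of `code i`. -/
def UniformlyGenerated {ι : Type*} (code : ι → List Bool) (N : ι → ℕ)
    (C : ∀ i, RevCircuit (N i)) : Prop :=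
  ∃ (gen : Cmd) (t : Polynomial ℕ), ∀ i,
    gen.OutputsIn [code i] (C i).encode (t.eval (code i).length)

/-! ### The quantum circuit -/

/-- Matrices on the state space of `N` qubits, in the computational basis. -/
abbrev QMatrix (N : ℕ) : Type := Matrix (Fin N → Bool) (Fin N → Bool) ℂ

/-- The Hadamard gate. -/
noncomputable def hadamard : Matrix Bool Bool ℂ :=
  Matrix.of fun a b => (if a && b then -1 else 1) / (Real.sqrt 2 : ℂ)

/-- `H^{⊗(N-1)} ⊗ I`: a Hadamard gate on every qubit except the last. -/
noncomputable def hadamardLayer (N : ℕ) : QMatrix N :=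
  Matrix.of fun a b =>
    ∏ i : Fin N, (if (i : ℕ) + 1 = N then (1 : Matrix Bool Bool ℂ) else hadamard) (a i) (b i)

/-- The permutation `π` applied coherently: `|w⟩ ↦ |π(w)⟩`. -/
def coherent {N : ℕ} (π : Equiv.Perm (Fin N → Bool)) : QMatrix N :=
  Matrix.of fun a w => if a = π w then 1 else 0

/-- The state `(H^{⊗(N-1)} ⊗ I) C (H^{⊗(N-1)} ⊗ I) |0^N⟩`. -/
noncomputable def hc1qState {N : ℕ} (C : RevCircuit N) : (Fin N → Bool) → ℂ :=
  (hadamardLayer N * coherent C.perm * hadamardLayer N).mulVec (Pi.single (fun _ => false) 1)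

/-- Probability of the result `z` when the qubits in `M` are measured in the computational basis:
the marginal on `M` of the output distribution of the HC1Q circuit. -/
noncomputable def hc1qProb {N : ℕ} (C : RevCircuit N) (M : Finset (Fin N)) (z : M → Bool) : ℝ :=
  ∑ w : Fin N → Bool, if (∀ i : M, w i = z i) then ‖hc1qState C w‖ ^ 2 else 0

/-! ### Classical sampling -/

/-- The set of measured qubits, as a string of `N` bits. -/
def encodeSet {N : ℕ} (M : Finset (Fin N)) : List Bool :=
  (List.finRange N).map fun i => decide (i ∈ M)

/-- A measurement result, as the string of its bits in the order of the qubits. -/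
def encodeResult {N : ℕ} {M : Finset (Fin N)} (z : M → Bool) : List Bool :=
  (List.finRange N).filterMap fun i => if h : i ∈ M then some (z ⟨i, h⟩) else none

/-- Probability that `out ρ = z` for a uniformly random `ρ ∈ {0,1}^m`. -/
noncomputable def coinProb {α : Type*} [DecidableEq α] {m : ℕ} (out : (Fin m → Bool) → α)
    (z : α) : ℝ :=
  ((Finset.univ.filter fun ρ : Fin m → Bool => out ρ = z).card : ℝ) / 2 ^ m

/-! Write π for the permutation of the circuit, l for the last wire, and expand the square in
`hc1qProb` over pairs of paths x, y. Summing over the outcomes on an unmeasured wire forces π x and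
π y to agree there, because the columns of each one-qubit matrix are orthonormal. Hence π y = π x ⊕
α with α supported on M. On a measured Hadamard wire the product of the two entries is (-1)^(α ζ)/2,
independent of π x. Wire l requires α to vanish there, and if l is measured, π x to agree with ζ
there. The partner y = π⁻¹(π x ⊕ α) is computable because the circuit can be run backwards, and it
counts only if its last bit is false.

So the probability of ζ is the mean, over uniform x with last bit cleared, of `quasiWeight` divided
by 2^|M \ {l}| (`hc1qProb_eq`). These quasi-probabilities may be negative, but they sum to 1 over ζ
(`sum_quasiWeight`) and are bounded by 1 in absolute value (`abs_quasiWeight_le`). As |M| is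
logarithmic, there are polynomially many α and ζ, and all quasi-probabilities at one x can be
computed exactly.

The algorithm averages over k² random inputs, cuts negative weights off at zero, and selects an
outcome in proportion to the remaining integer weights by reducing a random J-bit number modulo
their sum. A second-moment bound gives mean error 2/k per outcome (`sum_abs_mean_sub_le`), cutting
off and normalizing at most triples the total (`sum_abs_sub_normalized_posPart_le`), and the
reduction costs at most the sum of the weights divided by 2^J (`sum_abs_selectIndex_sub_le`). These
combine in `sampling_error`.

The running time is handled by the predicate `PT`, which is closed under composition, branching,
bounded iteration and calls of a given program (`PT.cut`, `PT.case`, `PT.iterate`, `PT.call`). Its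
convention is that variables sit in fixed registers below b, all registers from b on are empty, and
only register b changes. Numbers are kept in unary, which is affordable because every intermediate
value is polynomially bounded; the random J-bit number is not, and is therefore reduced digit by
digit. -/

/-! ### Polynomially bounded functions -/

/-- `f` is bounded by a polynomial in the size `sz`. -/
def PolyBdd {A : Type*} (sz f : A → ℕ) : Prop :=
  ∃ p : Polynomial ℕ, ∀ a, f a ≤ p.eval (sz a)

theorem Polynomial.eval_nat_mono (p : Polynomial ℕ) {x y : ℕ} (h : x ≤ y) :
    p.eval x ≤ p.eval y := by
  rw [Polynomial.eval_eq_sum_range, Polynomial.eval_eq_sum_range]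
  gcongr

namespace PolyBdd

variable {A B : Type*} {sz f g : A → ℕ}

theorem mono (hg : PolyBdd sz g) (h : ∀ a, f a ≤ g a) : PolyBdd sz f := by
  obtain ⟨p, hp⟩ := hg
  exact ⟨p, fun a => (h a).trans (hp a)⟩

theorem const (n : ℕ) : PolyBdd sz (fun _ => n) := ⟨Polynomial.C n, by simp⟩

theorem size : PolyBdd sz sz := ⟨Polynomial.X, by simp⟩

theorem add (hf : PolyBdd sz f) (hg : PolyBdd sz g) : PolyBdd sz (fun a => f a + g a) := by
  obtain ⟨p, hp⟩ := hf
  obtain ⟨q, hq⟩ := hg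
  exact ⟨p + q, fun a => by simpa using add_le_add (hp a) (hq a)⟩

theorem mul (hf : PolyBdd sz f) (hg : PolyBdd sz g) : PolyBdd sz (fun a => f a * g a) := by
  obtain ⟨p, hp⟩ := hf
  obtain ⟨q, hq⟩ := hg
  exact ⟨p * q, fun a => by simpa using Nat.mul_le_mul (hp a) (hq a)⟩

theorem eval (hf : PolyBdd sz f) (p : Polynomial ℕ) : PolyBdd sz (fun a => p.eval (f a)) := by
  obtain ⟨q, hq⟩ := hf
  exact ⟨p.comp q, fun a => by simpa using p.eval_nat_mono (hq a)⟩

theorem lift {sz' : B → ℕ} (hf : PolyBdd sz f) (π : B → A)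
    (hπ : PolyBdd sz' (fun b => sz (π b))) : PolyBdd sz' (fun b => f (π b)) := by
  obtain ⟨p, hp⟩ := hf
  exact (hπ.eval p).mono fun b => hp (π b)

end PolyBdd

/-! ### Execution of programs -/

namespace Cmd

/-- All registers shifted by `b`. -/
def shift (b : ℕ) : Cmd → Cmd
  | skip => skip
  | push r x => push (r + b) x
  | pop r => pop (r + b)
  | seq c d => seq (c.shift b) (d.shift b)
  | case r c₀ c₁ c₂ => case (r + b) (c₀.shift b) (c₁.shift b) (c₂.shift b)
  | loop r c => loop (r + b) (c.shift b)

/-- A bound on the registers that a program mentions. -/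
def bound : Cmd → ℕ
  | skip => 0
  | push r _ => r + 1
  | pop r => r + 1
  | seq c d => max c.bound d.bound
  | case r c₀ c₁ c₂ => max (r + 1) (max c₀.bound (max c₁.bound c₂.bound))
  | loop r c => max (r + 1) c.bound

/-- The store that agrees with `S` below `b` and holds `s` from `b` on. -/
def splice (b : ℕ) (S s : Store) : Store := fun r => if r < b then S r else s (r - b)

theorem splice_update (b : ℕ) (S s : Store) (r : ℕ) (l : List Bool) :
    splice b S (Function.update s r l) = Function.update (splice b S s) (r + b) l := by
  funext k
  unfold splice
  by_cases h : k = r + b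
  · subst h; simp
  · rw [Function.update_of_ne h]
    split_ifs with h1
    · rfl
    · rw [Function.update_of_ne (by omega)]

theorem splice_add (b : ℕ) (S s : Store) (r : ℕ) : splice b S s (r + b) = s r := by
  simp [splice]

/-- Execution commutes with renaming registers, and the registers below b act as an untouched frame.
This lets a foreign program run above the registers in use. -/
theorem Exec.shift {c : Cmd} {s s' : Store} {n : ℕ} (h : Exec c s n s') (b : ℕ) (S : Store) :
    Exec (c.shift b) (splice b S s) n (splice b S s') := by
  induction h with
  | skip => exact .skip _
  | push s r x =>
    rw [splice_update]
    have := Exec.push (splice b S s) (r + b) x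
    rwa [splice_add] at this
  | pop s r =>
    rw [splice_update]
    have := Exec.pop (splice b S s) (r + b)
    rwa [splice_add] at this
  | seq _ _ ih₁ ih₂ => exact .seq ih₁ ih₂
  | caseNil h _ ih => exact .caseNil (by rwa [splice_add]) ih
  | caseFalse h _ ih => exact .caseFalse (by rwa [splice_add]) ih
  | caseTrue h _ ih => exact .caseTrue (by rwa [splice_add]) ih
  | loopDone h => exact .loopDone (by rwa [splice_add])
  | loopStep h _ _ ih₁ ih₂ => exact .loopStep (by rwa [splice_add]) ih₁ ih₂

/-- Only finitely many registers can be dirty after a run, so a fixed program can clean up. -/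
theorem Exec.eq_of_bound_le {c : Cmd} {s s' : Store} {n : ℕ} (h : Exec c s n s') {r : ℕ}
    (hr : c.bound ≤ r) : s' r = s r := by
  induction h with
  | skip => rfl
  | push s k x => simp only [bound] at hr; rw [Function.update_of_ne (by omega)]
  | pop s k => simp only [bound] at hr; rw [Function.update_of_ne (by omega)]
  | seq _ _ ih₁ ih₂ =>
    simp only [bound, max_le_iff] at hr
    rw [ih₂ hr.2, ih₁ hr.1]
  | caseNil _ _ ih => simp only [bound, max_le_iff] at hr; exact ih hr.2.1
  | caseFalse _ _ ih => simp only [bound, max_le_iff] at hr; exact ih hr.2.2.1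
  | caseTrue _ _ ih => simp only [bound, max_le_iff] at hr; exact ih hr.2.2.2
  | loopDone => rfl
  | loopStep _ _ _ ih₁ ih₂ =>
    rw [ih₂ hr]
    simp only [bound, max_le_iff] at hr
    exact ih₁ hr.2

/-- A step pushes at most one bit, so a time bound also bounds the size of the output and of the
garbage. -/
theorem Exec.length_le {c : Cmd} {s s' : Store} {n : ℕ} (h : Exec c s n s') (r : ℕ) :
    (s' r).length ≤ (s r).length + n := by
  induction h with
  | skip => omega
  | push s k x =>
    by_cases hk : r = k
    · subst hk; simp
    · rw [Function.update_of_ne hk]; omega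
  | pop s k =>
    by_cases hk : r = k
    · subst hk; simp; omega
    · rw [Function.update_of_ne hk]; omega
  | _ => omega

/-- The program `c` leads from `s` to `s'` in at most `t` steps. -/
def ExecLE (c : Cmd) (s : Store) (t : ℕ) (s' : Store) : Prop := ∃ n ≤ t, Exec c s n s'

theorem ExecLE.mono {c : Cmd} {s s' : Store} {t u : ℕ} (h : ExecLE c s t s') (htu : t ≤ u) :
    ExecLE c s u s' := by
  obtain ⟨n, hn, h⟩ := h
  exact ⟨n, hn.trans htu, h⟩

theorem ExecLE.seq {c d : Cmd} {s s' s'' : Store} {t u : ℕ} (h : ExecLE c s t s')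
    (h' : ExecLE d s' u s'') : ExecLE (seq c d) s (t + u) s'' := by
  obtain ⟨n, hn, h⟩ := h
  obtain ⟨m, hm, h'⟩ := h'
  exact ⟨n + m, add_le_add hn hm, .seq h h'⟩

/-- Remove the contents of register `r`. -/
def clear (r : ℕ) : Cmd := loop r (pop r)

theorem exec_clear (r : ℕ) (s : Store) :
    ExecLE (clear r) s (2 * (s r).length + 1) (Function.update s r []) := by
  generalize hl : s r = l
  induction l generalizing s with
  | nil => exact ⟨1, by simp, by rw [← hl, Function.update_eq_self]; exact .loopDone hl⟩
  | cons x l ih =>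
    obtain ⟨n, hn, h⟩ := ih (Function.update s r l) (by simp)
    refine ⟨1 + n + 1, by simp; omega, .loopStep (by simp [hl]) (.pop s r) ?_⟩
    rw [Function.update_idem] at h
    rwa [hl]

/-- Empty register `r` onto the registers `r₁` and `r₂`, reversing its contents. -/
def pour (r r₁ r₂ : ℕ) : Cmd :=
  loop r (seq (case r skip (seq (push r₁ false) (push r₂ false))
    (seq (push r₁ true) (push r₂ true))) (pop r))

theorem exec_pour {r r₁ r₂ : ℕ} (h₁ : r ≠ r₁) (h₂ : r ≠ r₂) (h₁₂ : r₁ ≠ r₂) (s : Store) :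
    ExecLE (pour r r₁ r₂) s (5 * (s r).length + 1)
      (Function.update (Function.update (Function.update s r₁ ((s r).reverse ++ s r₁))
        r₂ ((s r).reverse ++ s r₂)) r []) := by
  generalize hl : s r = l
  induction l generalizing s with
  | nil =>
    refine ⟨1, by simp, ?_⟩
    simp only [List.reverse_nil, List.nil_append, Function.update_eq_self]
    rw [← hl, Function.update_eq_self]; exact .loopDone hl
  | cons x l ih =>
    obtain ⟨n, hn, h⟩ := ih (Function.update (Function.update (Function.update s r₁ (x :: s r₁))
        r₂ (x :: s r₂)) r l) (by simp)
    -- One round costs 3 for the branch with its two pushes, 1 for the pop and 1 for the loop test.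
    refine ⟨3 + 1 + n + 1, by simp; omega, .loopStep (by simp [hl])
      (.seq (s' := Function.update (Function.update s r₁ (x :: s r₁)) r₂ (x :: s r₂)) ?_
        (.pop _ r)) ?_⟩
    · have key : ∀ x, Exec (seq (push r₁ x) (push r₂ x)) s 2
          (Function.update (Function.update s r₁ (x :: s r₁)) r₂ (x :: s r₂)) := by
        intro x
        have := Exec.seq (.push s r₁ x) (.push (Function.update s r₁ (x :: s r₁)) r₂ x)
        rwa [Function.update_of_ne h₁₂.symm] at this
      cases x
      · exact .caseFalse (by simp [hl]) (key _)
      · exact .caseTrue (by simp [hl]) (key _)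
    · have tl : (Function.update (Function.update s r₁ (x :: s r₁)) r₂ (x :: s r₂) r).tail = l := by
        simp [h₁, h₂, hl]
      rw [tl]
      change Exec (pour r r₁ r₂) _ _ _
      convert h using 1
      · funext k
        by_cases k0 : k = r
        · subst k0; simp
        by_cases k2 : k = r₂
        · subst k2; simp [k0]
        by_cases k1 : k = r₁
        · subst k1; simp [k0, k2]
        simp [k0, k1, k2]

/-- Move the contents of register `r` to register `d`, using the empty registers `t` and
`t + 1`. -/
def move (r d t : ℕ) : Cmd := seq (pour r t (t + 1)) (seq (clear (t + 1))
  (seq (pour t d (t + 1)) (clear (t + 1))))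

/-- Copy register `r` to register `d`, using the empty registers `t` and `t + 1`. -/
def copy (r d t : ℕ) : Cmd := seq (pour r t (t + 1)) (seq (clear (t + 1))
  (pour t r d))

/-- Two pours restore the order of the bits. As `pour` always writes two copies, the surplus one in
t + 1 is cleared after each pour. -/
theorem exec_move {r d t : ℕ} {s : Store} (h : r ≠ d) (h₁ : r ≠ t) (h₂ : r ≠ t + 1)
    (h₃ : d ≠ t) (h₄ : d ≠ t + 1)
    (hd : s d = []) (hd₁ : s t = []) (hd₂ : s (t + 1) = []) :
    ExecLE (move r d t) s (14 * (s r).length + 4)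
      (Function.update (Function.update s d (s r)) r []) := by
  have e1 := exec_pour h₁ h₂ (by omega) s
  have e2 := exec_clear (t + 1) (Function.update (Function.update (Function.update s t
    ((s r).reverse ++ s t)) (t + 1) ((s r).reverse ++ s (t + 1))) r [])
  set s2 := Function.update (Function.update (Function.update (Function.update s t
    ((s r).reverse ++ s t)) (t + 1) ((s r).reverse ++ s (t + 1))) r []) (t + 1) [] with hs2
  have e3 := exec_pour (r := t) (r₁ := d) (r₂ := t + 1) (by omega) (by omega) (by omega) s2
  set s3 := Function.update (Function.update (Function.update s2 d
    ((s2 t).reverse ++ s2 d)) (t + 1) ((s2 t).reverse ++ s2 (t + 1))) t [] with hs3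
  have e4 := exec_clear (t + 1) s3
  have l2 : (Function.update (Function.update (Function.update s t
    ((s r).reverse ++ s t)) (t + 1) ((s r).reverse ++ s (t + 1))) r [] (t + 1)).length =
      (s r).length := by
    rw [Function.update_of_ne h₂.symm]; simp [hd₂]
  have v2 : s2 t = (s r).reverse := by simp [hs2, h₁.symm, hd₁]
  have v2' : s2 (t + 1) = [] := by simp [hs2]
  have v2'' : s2 d = [] := by simp [hs2, h.symm, h₃, h₄, hd]
  have l3 : (s3 (t + 1)).length = (s r).length := by simp [hs3, v2, v2']
  have e := e1.seq (e2.seq (e3.seq e4))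
  have fin : Function.update s3 (t + 1) [] = Function.update (Function.update s d (s r)) r [] := by
    funext k
    by_cases k2 : k = t + 1
    · subst k2; simp [h₂.symm, h₄.symm, hd₂]
    by_cases k1 : k = t
    · subst k1; simp [hs3, h₁.symm, h₃.symm, hd₁]
    by_cases k0 : k = d
    · subst k0; simp [hs3, h.symm, h₃, h₄, v2, v2'']
    simp only [hs3, hs2, Function.update_of_ne k2, Function.update_of_ne k1,
      Function.update_of_ne k0]
    by_cases kr : k = r
    · subst kr; simp
    · simp [kr, k1, k2, k0]
  rw [fin] at e
  refine e.mono ?_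
  rw [l2, l3, v2, List.length_reverse]
  omega

/-- Here both copies of the second pour are wanted: one restores r, the other fills d. -/
theorem exec_copy {r d t : ℕ} {s : Store} (h : r ≠ d) (h₁ : r ≠ t) (h₂ : r ≠ t + 1)
    (h₃ : d ≠ t) (h₄ : d ≠ t + 1)
    (hd : s d = []) (hd₁ : s t = []) (hd₂ : s (t + 1) = []) :
    ExecLE (copy r d t) s (12 * (s r).length + 3) (Function.update s d (s r)) := by
  have e1 := exec_pour h₁ h₂ (by omega) s
  have e2 := exec_clear (t + 1) (Function.update (Function.update (Function.update s t
    ((s r).reverse ++ s t)) (t + 1) ((s r).reverse ++ s (t + 1))) r [])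
  set s2 := Function.update (Function.update (Function.update (Function.update s t
    ((s r).reverse ++ s t)) (t + 1) ((s r).reverse ++ s (t + 1))) r []) (t + 1) [] with hs2
  have e3 := exec_pour (r := t) (r₁ := r) (r₂ := d) (by omega) (by omega) (by omega) s2
  have l2 : (Function.update (Function.update (Function.update s t
    ((s r).reverse ++ s t)) (t + 1) ((s r).reverse ++ s (t + 1))) r [] (t + 1)).length =
      (s r).length := by
    rw [Function.update_of_ne h₂.symm]; simp [hd₂]
  have v2 : s2 t = (s r).reverse := by simp [hs2, h₁.symm, hd₁]
  have v2' : s2 r = [] := by simp [hs2, h₂]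
  have v2'' : s2 d = [] := by simp [hs2, h.symm, h₃, h₄, hd]
  have e := e1.seq (e2.seq e3)
  rw [v2, v2', v2'', List.reverse_reverse, List.append_nil] at e
  have fin : Function.update (Function.update (Function.update s2 r (s r)) d (s r)) t []
      = Function.update s d (s r) := by
    funext k
    by_cases k1 : k = t
    · subst k1; simp [h₃.symm, hd₁]
    by_cases k0 : k = d
    · subst k0; simp [k1]
    by_cases kr : k = r
    · subst kr; simp [k1, k0]
    by_cases k2 : k = t + 1
    · subst k2; simp [hs2, kr, h₄.symm, hd₂]
    simp [hs2, k0, k1, k2, kr]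
  rw [fin] at e
  refine e.mono ?_
  rw [l2, List.length_reverse]
  omega

/-- Remove the contents of the registers `b, …, b + k - 1`. -/
def clearRange (b : ℕ) : ℕ → Cmd
  | 0 => skip
  | k + 1 => seq (clearRange b k) (clear (b + k))

theorem exec_clearRange (b k B : ℕ) (s : Store) (hB : ∀ r, b ≤ r → (s r).length ≤ B) :
    ExecLE (clearRange b k) s (k * (2 * B + 1) + 1)
      (fun r => if b ≤ r ∧ r < b + k then [] else s r) := by
  induction k with
  | zero =>
    refine ⟨1, by simp, ?_⟩
    have : (fun r => if b ≤ r ∧ r < b + 0 then [] else s r) = s := by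
      funext r; rw [if_neg (by omega)]
    rw [this]; exact .skip s
  | succ k ih =>
    have e := ih.seq (exec_clear (b + k) _)
    have fin : Function.update (fun r => if b ≤ r ∧ r < b + k then [] else s r) (b + k) [] =
        (fun r => if b ≤ r ∧ r < b + (k + 1) then [] else s r) := by
      funext r
      by_cases h : r = b + k
      · subst h; simp
      · rw [Function.update_of_ne h]
        by_cases h' : b ≤ r ∧ r < b + k
        · rw [if_pos h', if_pos (by omega)]
        · rw [if_neg h', if_neg (by omega)]
    rw [fin] at e
    refine e.mono ?_
    have := hB (b + k) (by omega)
    rw [if_neg (by omega)]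
    calc _ ≤ k * (2 * B + 1) + 1 + (2 * B + 1) := by omega
      _ = _ := by ring

end Cmd

/-- One program leads from `s` to `s'` in polynomial time whenever `Q a s s'` holds. -/
def Runs {A : Type*} (sz : A → ℕ) (Q : A → Store → Store → Prop) : Prop :=
  ∃ (c : Cmd) (t : A → ℕ), PolyBdd sz t ∧ ∀ a s s', Q a s s' → c.ExecLE s (t a) s'

/-! ### Program constructors as polynomial-time relations between stores. -/

namespace Runs

variable {A : Type*} {sz : A → ℕ} {Q Q₁ Q₂ : A → Store → Store → Prop}

theorem mono (h : Runs sz Q₁) (hQ : ∀ a s s', Q a s s' → Q₁ a s s') : Runs sz Q := by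
  obtain ⟨c, t, ht, h⟩ := h
  exact ⟨c, t, ht, fun a s s' hs => h a s s' (hQ a s s' hs)⟩

theorem seq (h₁ : Runs sz Q₁) (h₂ : Runs sz Q₂)
    (hQ : ∀ a s s'', Q a s s'' → ∃ s', Q₁ a s s' ∧ Q₂ a s' s'') : Runs sz Q := by
  obtain ⟨c, t, ht, h₁⟩ := h₁
  obtain ⟨d, u, hu, h₂⟩ := h₂
  refine ⟨c.seq d, _, ht.add hu, fun a s s'' hs => ?_⟩
  obtain ⟨s', h, h'⟩ := hQ a s s'' hs
  exact (h₁ a s s' h).seq (h₂ a s' s'' h')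

theorem clear (r : ℕ) {l : A → ℕ} (hl : PolyBdd sz l) :
    Runs sz (fun a s s' => (s r).length ≤ l a ∧ s' = Function.update s r []) :=
  ⟨Cmd.clear r, fun a => 2 * l a + 1, ((PolyBdd.const 2).mul hl).add (.const 1),
    fun _ s _ ⟨h, e⟩ =>
      e ▸ (Cmd.exec_clear r s).mono (Nat.add_le_add_right (Nat.mul_le_mul_left _ h) _)⟩

theorem copy {r d t : ℕ} (h : r ≠ d) (h₁ : r ≠ t) (h₂ : r ≠ t + 1) (h₃ : d ≠ t) (h₄ : d ≠ t + 1)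
    {l : A → ℕ} (hl : PolyBdd sz l) :
    Runs sz (fun a s s' => (s r).length ≤ l a ∧ s d = [] ∧ s t = [] ∧ s (t + 1) = [] ∧
      s' = Function.update s d (s r)) :=
  ⟨Cmd.copy r d t, fun a => 12 * l a + 3, ((PolyBdd.const 12).mul hl).add (.const 3),
    fun _ _ _ ⟨hl, hd, ht, ht', e⟩ =>
      e ▸ (Cmd.exec_copy h h₁ h₂ h₃ h₄ hd ht ht').mono
        (Nat.add_le_add_right (Nat.mul_le_mul_left _ hl) _)⟩

theorem move {r d t : ℕ} (h : r ≠ d) (h₁ : r ≠ t) (h₂ : r ≠ t + 1) (h₃ : d ≠ t) (h₄ : d ≠ t + 1)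
    {l : A → ℕ} (hl : PolyBdd sz l) :
    Runs sz (fun a s s' => (s r).length ≤ l a ∧ s d = [] ∧ s t = [] ∧ s (t + 1) = [] ∧
      s' = Function.update (Function.update s d (s r)) r []) :=
  ⟨Cmd.move r d t, fun a => 14 * l a + 4, ((PolyBdd.const 14).mul hl).add (.const 4),
    fun _ _ _ ⟨hl, hd, ht, ht', e⟩ =>
      e ▸ (Cmd.exec_move h h₁ h₂ h₃ h₄ hd ht ht').mono
        (Nat.add_le_add_right (Nat.mul_le_mul_left _ hl) _)⟩

theorem push (r : ℕ) (x : Bool) :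
    Runs sz (fun _ s s' => s' = Function.update s r (x :: s r)) :=
  ⟨.push r x, fun _ => 1, .const 1, fun _ s _ e => ⟨1, le_rfl, e ▸ .push s r x⟩⟩

theorem pop (r : ℕ) : Runs sz (fun _ s s' => s' = Function.update s r (s r).tail) :=
  ⟨.pop r, fun _ => 1, .const 1, fun _ s _ e => ⟨1, le_rfl, e ▸ .pop s r⟩⟩

theorem skip : Runs sz (fun _ s s' => s' = s) :=
  ⟨.skip, fun _ => 1, .const 1, fun _ s _ e => ⟨1, le_rfl, e ▸ .skip s⟩⟩

theorem case (r : ℕ) {Q₀ : A → Store → Store → Prop} (h₀ : Runs sz Q₀) (h₁ : Runs sz Q₁)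
    (h₂ : Runs sz Q₂) :
    Runs sz (fun a s s' => (s r = [] → Q₀ a s s') ∧ ((s r).head? = some false → Q₁ a s s') ∧
      ((s r).head? = some true → Q₂ a s s')) := by
  obtain ⟨c₀, t₀, b₀, h₀⟩ := h₀
  obtain ⟨c₁, t₁, b₁, h₁⟩ := h₁
  obtain ⟨c₂, t₂, b₂, h₂⟩ := h₂
  refine ⟨.case r c₀ c₁ c₂, _, ((b₀.add b₁).add b₂).add (.const 1), fun a s s' ⟨q₀, q₁, q₂⟩ => ?_⟩
  rcases hs : s r with _ | ⟨_ | _, l⟩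
  · obtain ⟨n, hn, h⟩ := h₀ a s s' (q₀ hs)
    exact ⟨n + 1, by omega, .caseNil hs h⟩
  · have hs' : (s r).head? = some false := by simp [hs]
    obtain ⟨n, hn, h⟩ := h₁ a s s' (q₁ hs')
    exact ⟨n + 1, by omega, .caseFalse hs' h⟩
  · have hs' : (s r).head? = some true := by simp [hs]
    obtain ⟨n, hn, h⟩ := h₂ a s s' (q₂ hs')
    exact ⟨n + 1, by omega, .caseTrue hs' h⟩

/-- The body is specified with the round number as an extra parameter counted in the size. Rounds
stay below m a, so a single polynomial bounds the cost of each of them. The run is given by its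
sequence of intermediate stores. -/
theorem loop (r : ℕ) {R : A × ℕ → Store → Store → Prop}
    (h : Runs (fun p : A × ℕ => sz p.1 + p.2) R) {m : A → ℕ} (hm : PolyBdd sz m) :
    Runs sz (fun a s s' => ∃ (n : ℕ) (st : ℕ → Store), n ≤ m a ∧ st 0 = s ∧ st n = s' ∧
      st n r = [] ∧ ∀ i < n, st i r ≠ [] ∧ R (a, i) (st i) (st (i + 1))) := by
  obtain ⟨c, t, ⟨p, hp⟩, h⟩ := h
  refine ⟨.loop r c, fun a => m a * (p.eval (sz a + m a) + 1) + 1,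
    ((hm.mul (((PolyBdd.size.add hm).eval p).add (.const 1))).add (.const 1)), ?_⟩
  rintro a s s' ⟨n, st, hn, rfl, rfl, hr, hst⟩
  -- Induction on the number of remaining rounds, since a loop unfolds at its first round.
  have key : ∀ k ≤ n, Cmd.ExecLE (.loop r c) (st (n - k)) (k * (p.eval (sz a + m a) + 1) + 1)
      (st n) := by
    intro k hk
    induction k with
    | zero => exact ⟨1, by simp, .loopDone hr⟩
    | succ k ih =>
      obtain ⟨u, hu, e⟩ := ih (by omega)
      obtain ⟨h₁, h₂⟩ := hst (n - (k + 1)) (by omega)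
      obtain ⟨v, hv, e'⟩ := h _ _ _ h₂
      rw [show n - (k + 1) + 1 = n - k by omega] at e'
      refine ⟨v + u + 1, ?_, .loopStep h₁ e' e⟩
      have : v ≤ p.eval (sz a + m a) :=
        hv.trans ((hp _).trans (p.eval_nat_mono (by dsimp only; omega)))
      calc v + u + 1 ≤ p.eval (sz a + m a) + (k * (p.eval (sz a + m a) + 1) + 1) + 1 := by omega
        _ = _ := by ring
  have := key n le_rfl
  rw [Nat.sub_self] at this
  exact this.mono (Nat.add_le_add_right (Nat.mul_le_mul_right _ hn) _)

end Runs

/-- `f` is computable in polynomial time from the variables in `V`: some program leaves the value of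
`f` in the first free register and changes nothing else. -/
structure PT {A : Type*} (sz : A → ℕ) (V : Set (A → List Bool)) (f : A → List Bool) : Prop where
  bdd : PolyBdd sz (fun a => (f a).length)
  runs : ∀ (b : ℕ) (Q : A → Store → Prop), (∀ a s, Q a s → ∀ r ≥ b, s r = []) →
    (∀ v ∈ V, ∃ r < b, ∀ a s, Q a s → s r = v a) →
    Runs sz (fun a s s' => Q a s ∧ s' = Function.update s b (f a))

/-! ### Closure properties of polynomial-time computability. -/

namespace PT

variable {A B : Type*} {sz : A → ℕ} {V W : Set (A → List Bool)} {f g h ℓ : A → List Bool}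

theorem var (hf : f ∈ V) (hb : PolyBdd sz (fun a => (f a).length)) : PT sz V f := by
  refine ⟨hb, fun b Q hQ hV => ?_⟩
  obtain ⟨r, hr, hv⟩ := hV f hf
  refine (Runs.copy (r := r) (d := b) (t := b + 1) (by omega) (by omega) (by omega) (by omega)
    (by omega) hb).mono ?_
  rintro a s s' ⟨h, rfl⟩
  rw [hv a s h]
  exact ⟨le_rfl, hQ a s h _ (by omega), hQ a s h _ (by omega), hQ a s h _ (by omega), rfl⟩

theorem weaken (hf : PT sz V f) (h : V ⊆ W) : PT sz W f :=
  ⟨hf.bdd, fun b Q hQ hW => hf.runs b Q hQ fun v hv => hW v (h hv)⟩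

theorem comp {sz' : B → ℕ} {V' : Set (B → List Bool)} (hf : PT sz V f) (π : B → A)
    (hπ : PolyBdd sz' (fun b => sz (π b))) (hV : ∀ v ∈ V, (fun b => v (π b)) ∈ V') :
    PT sz' V' (fun b => f (π b)) := by
  refine ⟨hf.bdd.lift π hπ, fun b Q hQ hV' => ?_⟩
  -- The description of stores is pushed forward along π, so that the program for A serves all
  -- instances in B.
  obtain ⟨c, t, ⟨p, hp⟩, h⟩ := hf.runs b (fun a s => ∃ x, π x = a ∧ Q x s)
    (fun a s ⟨x, _, h⟩ => hQ x s h) (fun v hv => by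
      obtain ⟨r, hr, h⟩ := hV' _ (hV v hv)
      exact ⟨r, hr, fun a s ⟨x, e, hx⟩ => e ▸ h x s hx⟩)
  refine ⟨c, fun x => t (π x), PolyBdd.lift ⟨p, hp⟩ π hπ, fun x s s' ⟨hs, e⟩ => ?_⟩
  exact h (π x) s s' ⟨⟨x, rfl, hs⟩, e⟩

/-- Compute an auxiliary value first. -/
theorem cut (hf : PT sz V f) (hg : PT sz (insert f V) g) : PT sz V g := by
  refine ⟨hg.bdd, fun b Q hQ hV => ?_⟩
  have r₁ := hf.runs b Q hQ hV
  have r₂ := hg.runs (b + 1) (fun a s => ∃ s₀, Q a s₀ ∧ s = Function.update s₀ b (f a))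
    (by
      rintro a s ⟨s₀, h, rfl⟩ r hr
      rw [Function.update_of_ne (by omega)]
      exact hQ a s₀ h r (by omega))
    (by
      rintro v (rfl | hv)
      · exact ⟨b, by omega, by rintro a s ⟨s₀, h, rfl⟩; simp⟩
      · obtain ⟨r, hr, h⟩ := hV v hv
        refine ⟨r, by omega, ?_⟩
        rintro a s ⟨s₀, h', rfl⟩
        rw [Function.update_of_ne (by omega)]
        exact h a s₀ h')
  -- The auxiliary value in b is erased and the result moved down from b + 1, which restores the
  -- register convention.
  have r₃ := Runs.clear (sz := sz) b hf.bdd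
  have r₄ := Runs.move (sz := sz) (r := b + 1) (d := b) (t := b + 2) (by omega) (by omega)
    (by omega) (by omega) (by omega) hg.bdd
  have r₁₂ := Runs.seq (Q := fun a s s' => Q a s ∧ s' = Function.update
    (Function.update s b (f a)) (b + 1) (g a)) r₁ r₂ (by
      rintro a s s' ⟨h, rfl⟩
      exact ⟨_, ⟨h, rfl⟩, ⟨s, h, rfl⟩, rfl⟩)
  have r₁₂₃ := Runs.seq (Q := fun a s s' => Q a s ∧ s' = Function.update s (b + 1) (g a)) r₁₂ r₃ (by
      rintro a s s' ⟨h, rfl⟩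
      refine ⟨_, ⟨h, rfl⟩, by simp, ?_⟩
      funext k
      by_cases k0 : k = b
      · subst k0; simp [hQ a s h k le_rfl]
      · by_cases k1 : k = b + 1
        · subst k1; simp
        · simp [k0, k1])
  refine Runs.seq r₁₂₃ r₄ ?_
  rintro a s s' ⟨h, rfl⟩
  refine ⟨_, ⟨h, rfl⟩, by simp, ?_, ?_, ?_, ?_⟩
  · simp [hQ a s h]
  · simp [hQ a s h]
  · simpa using hQ a s h (b + 2 + 1) (by omega)
  · funext k
    by_cases k0 : k = b
    · subst k0; simp
    · by_cases k1 : k = b + 1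
      · subst k1; simp [hQ a s h]
      · simp [k0, k1]

theorem nil : PT sz V (fun _ => []) := by
  refine ⟨.const 0, fun b Q hQ _ => Runs.skip.mono ?_⟩
  rintro a s s' ⟨h, rfl⟩
  rw [← hQ a s h b le_rfl, Function.update_eq_self]

theorem cons (x : Bool) (hf : PT sz V f) : PT sz V (fun a => x :: f a) := by
  refine ⟨(hf.bdd.add (.const 1)).mono fun a => by simp, fun b Q hQ hV => ?_⟩
  refine Runs.seq (hf.runs b Q hQ hV) (Runs.push b x) ?_
  rintro a s s' ⟨h, rfl⟩
  exact ⟨_, ⟨h, rfl⟩, by simp⟩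

theorem tail (hf : PT sz V f) : PT sz V (fun a => (f a).tail) := by
  refine ⟨hf.bdd.mono fun a => by simp, fun b Q hQ hV => ?_⟩
  refine Runs.seq (hf.runs b Q hQ hV) (Runs.pop b) ?_
  rintro a s s' ⟨h, rfl⟩
  exact ⟨_, ⟨h, rfl⟩, by simp⟩

theorem case (hℓ : PT sz V ℓ) (hf : PT sz V f) (hg : PT sz V g) (hh : PT sz V h) :
    PT sz V (fun a => match ℓ a with | [] => f a | false :: _ => g a | true :: _ => h a) := by
  refine hℓ.cut ⟨((hf.bdd.add hg.bdd).add hh.bdd).mono fun a => ?_, fun b Q hQ hV => ?_⟩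
  · rcases ℓ a with _ | ⟨_ | _, l⟩ <;> dsimp only <;> omega
  · have hV' : ∀ v ∈ V, ∃ r < b, ∀ a s, Q a s → s r = v a := fun v hv => hV v (.inr hv)
    obtain ⟨r, hr, hl⟩ := hV ℓ (.inl rfl)
    refine (Runs.case r (hf.runs b Q hQ hV') (hg.runs b Q hQ hV') (hh.runs b Q hQ hV')).mono ?_
    rintro a s s' ⟨hs, rfl⟩
    rw [hl a s hs]
    refine ⟨fun e => ⟨hs, ?_⟩, fun e => ⟨hs, ?_⟩, fun e => ⟨hs, ?_⟩⟩
    · rw [e]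
    all_goals
      rcases hx : ℓ a with _ | ⟨_ | _, l⟩ <;> rw [hx] at e <;> simp at e ⊢

/-- The variables of `V` together with a counter in unary. -/
def withIdx (V : Set (A → List Bool)) : Set (A × ℕ → List Bool) :=
  insert (fun p => List.replicate p.2 true) ((fun v p => v p.1) '' V)

/-- The size of a pair of an input and a counter. -/
def szIdx (sz : A → ℕ) (p : A × ℕ) : ℕ := sz p.1 + p.2

theorem lift (hf : PT sz V f) : PT (szIdx sz) (withIdx V) (fun p => f p.1) :=
  hf.comp Prod.fst (PolyBdd.size.mono fun p => by simp [szIdx]) fun v hv => .inr ⟨v, hv, rfl⟩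

theorem idx : PT (szIdx sz) (withIdx V) (fun p => List.replicate p.2 true) :=
  .var (.inl rfl) (PolyBdd.size.mono fun p => by simp [szIdx])

/-- A loop that consumes a copy of ℓ, one bit per round. The size bound on `acc` is required for all
pairs of an input and an index, including indices that the loop never reaches. -/
theorem iterate (hℓ : PT sz V ℓ) (acc : A → ℕ → List Bool) (h₀ : PT sz V (fun a => acc a 0))
    (hacc : PolyBdd (szIdx sz) (fun p => (acc p.1 p.2).length))
    (hs : PT (szIdx sz) (insert (fun p => acc p.1 p.2) (withIdx V))
      (fun p => acc p.1 (p.2 + 1))) :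
    PT sz V (fun a => acc a (ℓ a).length) := by
  have hbd : PolyBdd sz (fun a => (acc a (ℓ a).length).length) := by
    obtain ⟨p, hp⟩ := hacc
    exact ((PolyBdd.size.add hℓ.bdd).eval p).mono fun a => hp (a, _)
  refine ⟨hbd, fun b Q hQ hV => ?_⟩
  -- Store after i rounds: the unconsumed part of ℓ in b, the state in b + 1, the round number in
  -- unary in b + 2. The body builds the next state in b + 3.
  let st : A → Store → ℕ → Store := fun a s i => Function.update (Function.update (Function.update s
    b ((ℓ a).drop i)) (b + 1) (acc a i)) (b + 2) (List.replicate i true)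
  have r₁ := hℓ.runs b Q hQ hV
  have r₂ := h₀.runs (b + 1) (fun a s => ∃ s₀, Q a s₀ ∧ s = Function.update s₀ b (ℓ a))
    (by
      rintro a s ⟨s₀, h, rfl⟩ r hr
      rw [Function.update_of_ne (by omega)]
      exact hQ a s₀ h r (by omega))
    (by
      intro v hv
      obtain ⟨r, hr, h⟩ := hV v hv
      refine ⟨r, by omega, ?_⟩
      rintro a s ⟨s₀, h', rfl⟩
      rw [Function.update_of_ne (by omega)]
      exact h a s₀ h')
  have r₁₂ := Runs.seq (Q := fun a s s' => Q a s ∧ s' = st a s 0) r₁ r₂ (by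
      rintro a s s' ⟨h, rfl⟩
      refine ⟨_, ⟨h, rfl⟩, ⟨s, h, rfl⟩, ?_⟩
      simp only [st, List.drop_zero, List.replicate_zero]
      rw [Function.update_eq_iff]
      simp [hQ a s h])
  have body₁ := hs.runs (b + 3) (fun p s => ∃ s₀, Q p.1 s₀ ∧ s = st p.1 s₀ p.2)
    (by
      rintro p s ⟨s₀, h, rfl⟩ r hr
      simp only [st]
      rw [Function.update_of_ne (by omega), Function.update_of_ne (by omega),
        Function.update_of_ne (by omega), hQ _ s₀ h r (by omega)])
    (by
      rintro v (rfl | rfl | ⟨w, hw, rfl⟩)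
      · exact ⟨b + 1, by omega, by rintro p s ⟨s₀, h, rfl⟩; simp [st]⟩
      · exact ⟨b + 2, by omega, by rintro p s ⟨s₀, h, rfl⟩; simp [st]⟩
      · obtain ⟨r, hr, h⟩ := hV w hw
        refine ⟨r, by omega, ?_⟩
        rintro p s ⟨s₀, h', rfl⟩
        simp only [st]
        rw [Function.update_of_ne (by omega), Function.update_of_ne (by omega),
          Function.update_of_ne (by omega), h _ s₀ h'])
  have body₂ := Runs.clear (sz := szIdx sz) (b + 1) hacc
  have body₃ := Runs.move (sz := szIdx sz) (r := b + 3) (d := b + 1) (t := b + 4) (by omega)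
    (by omega) (by omega) (by omega) (by omega) hs.bdd
  have body₄ := Runs.push (sz := szIdx sz) (b + 2) true
  have body₅ := Runs.pop (sz := szIdx sz) b
  have body₁₂ := Runs.seq (Q := fun p s s' => ∃ s₀, Q p.1 s₀ ∧ s = st p.1 s₀ p.2 ∧
      s' = Function.update (Function.update (st p.1 s₀ p.2) (b + 3) (acc p.1 (p.2 + 1)))
        (b + 1) []) body₁ body₂ (by
      rintro p s s' ⟨s₀, h, rfl, rfl⟩
      exact ⟨_, ⟨⟨s₀, h, rfl⟩, rfl⟩, by simp [st], rfl⟩)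
  have body₃ := Runs.seq (Q := fun p s s' => ∃ s₀, Q p.1 s₀ ∧ s = st p.1 s₀ p.2 ∧
      s' = Function.update (st p.1 s₀ p.2) (b + 1) (acc p.1 (p.2 + 1))) body₁₂ body₃ (by
      rintro p s s' ⟨s₀, h, rfl, rfl⟩
      refine ⟨_, ⟨s₀, h, rfl, rfl⟩, by simp, by simp, by simp [st, hQ _ s₀ h],
        by simpa [st, Nat.add_assoc] using hQ _ s₀ h (b + 4 + 1) (by omega), ?_⟩
      funext k
      by_cases k1 : k = b + 1
      · subst k1; simp
      · by_cases k3 : k = b + 3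
        · subst k3; simp [st, hQ _ s₀ h]
        · simp [k1, k3])
  have body₄ := Runs.seq (Q := fun p s s' => ∃ s₀, Q p.1 s₀ ∧ s = st p.1 s₀ p.2 ∧
      s' = Function.update (Function.update (st p.1 s₀ p.2) (b + 1) (acc p.1 (p.2 + 1)))
        (b + 2) (List.replicate (p.2 + 1) true)) body₃ body₄ (by
      rintro p s s' ⟨s₀, h, rfl, rfl⟩
      exact ⟨_, ⟨s₀, h, rfl, rfl⟩, by simp [st, List.replicate_succ]⟩)
  have body := Runs.seq (Q := fun p s s' => ∃ s₀, Q p.1 s₀ ∧ s = st p.1 s₀ p.2 ∧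
      s' = st p.1 s₀ (p.2 + 1)) body₄ body₅ (by
      rintro p s s' ⟨s₀, h, rfl, rfl⟩
      refine ⟨_, ⟨s₀, h, rfl, rfl⟩, ?_⟩
      funext k
      by_cases k0 : k = b
      · subst k0; simp [st]
      · by_cases k1 : k = b + 1
        · subst k1; simp [st]
        · by_cases k2 : k = b + 2
          · subst k2; simp [st]
          · simp [st, k0, k1, k2])
  have lp := Runs.loop b body hℓ.bdd
  have r₃ := Runs.seq (Q := fun a s s' => Q a s ∧ s' = st a s (ℓ a).length) r₁₂ lp (by
      rintro a s s' ⟨h, rfl⟩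
      refine ⟨_, ⟨h, rfl⟩, (ℓ a).length, st a s, le_rfl, rfl, rfl, by simp [st], fun i hi =>
        ⟨by simp [st, hi], s, h, rfl, rfl⟩⟩)
  have r₄ := Runs.clear (sz := sz) (b + 2) hℓ.bdd
  have r₅ := Runs.move (sz := sz) (r := b + 1) (d := b) (t := b + 2) (by omega) (by omega)
    (by omega) (by omega) (by omega) hbd
  have r₃₄ := Runs.seq (Q := fun a s s' => Q a s ∧
      s' = Function.update s (b + 1) (acc a (ℓ a).length)) r₃ r₄ (by
      rintro a s s' ⟨h, rfl⟩
      refine ⟨_, ⟨h, rfl⟩, by simp [st], ?_⟩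
      funext k
      by_cases k0 : k = b
      · subst k0; simp [st, hQ a s h]
      · by_cases k1 : k = b + 1
        · subst k1; simp [st]
        · by_cases k2 : k = b + 2
          · subst k2; simp [st, hQ a s h]
          · simp [st, k0, k1, k2])
  refine Runs.seq r₃₄ r₅ ?_
  rintro a s s' ⟨h, rfl⟩
  refine ⟨_, ⟨h, rfl⟩, by simp, by simp [hQ a s h], by simp [hQ a s h],
    by simpa using hQ a s h (b + 2 + 1) (by omega), ?_⟩
  funext k
  by_cases k0 : k = b
  · subst k0; simp
  · by_cases k1 : k = b + 1
    · subst k1; simp [hQ a s h]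
    · simp [k0, k1]

/-- A program that reads one input and leaves its result in register `0` can be called. -/
theorem call (hℓ : PT sz V ℓ) (c : Cmd) (t : Polynomial ℕ)
    (h : ∀ a, c.OutputsIn [ℓ a] (f a) (t.eval (ℓ a).length)) : PT sz V f := by
  have hlen : ∀ a, (f a).length ≤ (ℓ a).length + t.eval (ℓ a).length := by
    intro a
    obtain ⟨n, s, hn, he, e⟩ := h a
    rw [← e]
    have := he.length_le 0
    simp only [initStore, List.getD_cons_zero] at this
    omega
  refine ⟨(hℓ.bdd.add (hℓ.bdd.eval t)).mono hlen, fun b Q hQ hV => ?_⟩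
  refine Runs.seq (hℓ.runs b Q hQ hV) (Q₂ := fun a s s' => Q a (Function.update s b []) ∧
    s b = ℓ a ∧ s' = Function.update s b (f a)) ?_ (by
      rintro a s s' ⟨hs, rfl⟩
      refine ⟨_, ⟨hs, rfl⟩, ?_, by simp, by simp⟩
      rw [Function.update_idem, ← hQ a s hs b le_rfl, Function.update_eq_self]
      exact hs)
  have hB : PolyBdd sz (fun a => (ℓ a).length + t.eval (ℓ a).length) := hℓ.bdd.add (hℓ.bdd.eval t)
  refine ⟨(c.shift b).seq (Cmd.clearRange (b + 1) c.bound), _, (hℓ.bdd.eval t).add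
    (((PolyBdd.const c.bound).mul (((PolyBdd.const 2).mul hB).add (.const 1))).add (.const 1)), ?_⟩
  rintro a s s' ⟨hs, hb, rfl⟩
  obtain ⟨n, s₁, hn, he, h₀⟩ := h a
  have hs₀ : ∀ r > b, s r = [] := fun r hr => by
    have := hQ a _ hs r (by omega)
    rwa [Function.update_of_ne (by omega)] at this
  -- From register b on, the store looks like the initial store of c on its single input.
  have e₁ : Cmd.splice b s (initStore [ℓ a]) = s := by
    funext r
    unfold Cmd.splice
    split_ifs with hr
    · rfl
    · obtain rfl | hr' := (not_lt.mp hr).eq_or_lt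
      · simp [initStore, hb]
      · rw [hs₀ r hr']
        obtain ⟨k, hk⟩ : ∃ k, r - b = k + 1 := ⟨r - b - 1, by omega⟩
        simp [initStore, hk]
  have run := he.shift b s
  rw [e₁] at run
  have hlen' : ∀ r, b + 1 ≤ r →
      (Cmd.splice b s s₁ r).length ≤ (ℓ a).length + t.eval (ℓ a).length := by
    intro r hr
    have := run.length_le r
    rw [hs₀ r (by omega)] at this
    simp only [List.length_nil] at this
    omega
  have e := (Cmd.ExecLE.seq ⟨n, hn, run⟩ (Cmd.exec_clearRange (b + 1) c.bound _ _ hlen'))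
  -- Everything above b that c may have written is erased; registers beyond its bound were empty and
  -- still are.
  have fin : (fun r => if b + 1 ≤ r ∧ r < b + 1 + c.bound then [] else Cmd.splice b s s₁ r) =
      Function.update s b (f a) := by
    funext r
    rcases lt_trichotomy r b with hr | rfl | hr
    · rw [if_neg (by omega), Function.update_of_ne (by omega)]
      simp [Cmd.splice, hr]
    · simp [Cmd.splice, h₀]
    · rw [Function.update_of_ne (by omega), hs₀ r hr]
      split_ifs with hr'
      · rfl
      · rw [Cmd.splice, if_neg (by omega), he.eq_of_bound_le (by omega)]
        obtain ⟨k, hk⟩ : ∃ k, r - b = k + 1 := ⟨r - b - 1, by omega⟩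
        simp [initStore, hk]
  rwa [fin] at e

/-- A function that is computable from the inputs is computed by a program with its result in
register `0`. -/
theorem exists_outputsIn (inputs : A → List (List Bool)) (k : ℕ)
    (hk : ∀ a, (inputs a).length ≤ k + 1) (h₀ : PolyBdd sz (fun a => ((inputs a).getD 0 []).length))
    (hf : PT sz {v | ∃ r ≤ k, ∀ a, v a = (inputs a).getD r []} f) :
    ∃ (c : Cmd) (t : Polynomial ℕ), ∀ a, c.OutputsIn (inputs a) (f a) (t.eval (sz a)) := by
  have hfresh : ∀ a, ∀ r ≥ k + 1, initStore (inputs a) r = [] := fun a r hr =>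
    List.getD_eq_default _ _ ((hk a).trans hr)
  have r₁ := hf.runs (k + 1) (fun a s => s = initStore (inputs a))
    (by rintro a s rfl; exact hfresh a)
    (by
      rintro v ⟨r, hr, h⟩
      exact ⟨r, by omega, by rintro a s rfl; exact (h a).symm⟩)
  have r₂ := Runs.clear (sz := sz) 0 h₀
  have r₃ := Runs.move (sz := sz) (r := k + 1) (d := 0) (t := k + 2) (by omega) (by omega)
    (by omega) (by omega) (by omega) hf.bdd
  have r₁₂ := Runs.seq (Q := fun a s s' => s = initStore (inputs a) ∧
      s' = Function.update (Function.update s (k + 1) (f a)) 0 []) r₁ r₂ (by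
    rintro a s s' ⟨rfl, rfl⟩
    exact ⟨_, ⟨rfl, rfl⟩, by simp [initStore], rfl⟩)
  obtain ⟨c, t, ⟨p, hp⟩, h⟩ := Runs.seq (Q := fun a s s' => s = initStore (inputs a) ∧
      s' = Function.update (Function.update (Function.update (Function.update s (k + 1) (f a)) 0 [])
        0 (f a)) (k + 1) []) r₁₂ r₃ (by
    rintro a s s' ⟨rfl, rfl⟩
    refine ⟨_, ⟨rfl, rfl⟩, by simp, by simp, ?_, ?_, by simp⟩
    · simpa using hfresh a (k + 2) (by omega)
    · simpa using hfresh a (k + 2 + 1) (by omega))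
  refine ⟨c, p, fun a => ?_⟩
  obtain ⟨n, hn, e⟩ := h a _ _ ⟨rfl, rfl⟩
  exact ⟨n, _, hn.trans (hp a), e, by simp⟩

end PT

/-- A number that is computable in polynomial time in unary. -/
def PTN {A : Type*} (sz : A → ℕ) (V : Set (A → List Bool)) (n : A → ℕ) : Prop :=
  PT sz V (fun a => List.replicate (n a) true)

/-- A bit that is computable in polynomial time. -/
def PTB {A : Type*} (sz : A → ℕ) (V : Set (A → List Bool)) (c : A → Bool) : Prop :=
  PT sz V (fun a => [c a])

/-! ### Arithmetic on unary numbers and Boolean operations. -/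

section

variable {A : Type*} {sz : A → ℕ} {V W : Set (A → List Bool)} {f g ℓ : A → List Bool}
  {m n : A → ℕ} {c d : A → Bool}

open PT

theorem PT.congr (hf : PT sz V f) (h : ∀ a, f a = g a) : PT sz V g := funext h ▸ hf

namespace PTN

theorem congr (hm : PTN sz V m) (h : ∀ a, m a = n a) : PTN sz V n := funext h ▸ hm

theorem bdd (hn : PTN sz V n) : PolyBdd sz n := (PT.bdd hn).mono fun a => by simp

theorem weaken (hn : PTN sz V n) (h : V ⊆ W) : PTN sz W n := PT.weaken hn h

theorem lift (hn : PTN sz V n) : PTN (szIdx sz) (withIdx V) (fun p => n p.1) := PT.lift hn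

theorem idx : PTN (szIdx sz) (withIdx V) (fun p => p.2) := PT.idx

theorem var (h : (fun a => List.replicate (n a) true) ∈ V) (hn : PolyBdd sz n) : PTN sz V n :=
  PT.var h (hn.mono fun a => by simp)

/-- The counter of an indexed function may be any computed number, which is polynomially bounded
because it is held in unary. -/
theorem subst {f : A × ℕ → List Bool} (hf : PT (szIdx sz) (withIdx V) f) (hn : PTN sz V n) :
    PT sz V (fun a => f (a, n a)) := by
  refine PT.cut hn (hf.comp (fun a => (a, n a)) (PolyBdd.size.add hn.bdd) ?_)
  rintro v (rfl | ⟨w, hw, rfl⟩)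
  · exact .inl rfl
  · exact .inr hw

theorem iterate (hn : PTN sz V n) (acc : A → ℕ → List Bool) (h₀ : PT sz V (fun a => acc a 0))
    (hacc : PolyBdd (szIdx sz) (fun p => (acc p.1 p.2).length))
    (hs : PT (szIdx sz) (insert (fun p => acc p.1 p.2) (withIdx V))
      (fun p => acc p.1 (p.2 + 1))) :
    PT sz V (fun a => acc a (n a)) := by
  simpa using PT.iterate hn acc h₀ hacc hs

/-- Iteration with a number as the state. -/
theorem iterateN (hn : PTN sz V n) (acc : A → ℕ → ℕ) (h₀ : PTN sz V (fun a => acc a 0))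
    (hacc : PolyBdd (szIdx sz) (fun p => acc p.1 p.2))
    (hs : PTN (szIdx sz) (insert (fun p => List.replicate (acc p.1 p.2) true) (withIdx V))
      (fun p => acc p.1 (p.2 + 1))) :
    PTN sz V (fun a => acc a (n a)) :=
  iterate hn (fun a i => List.replicate (acc a i) true) h₀ (by simpa using hacc) hs

theorem zero : PTN sz V (fun _ => 0) := PT.nil

theorem succ (hn : PTN sz V n) : PTN sz V (fun a => n a + 1) := PT.cons true hn

theorem pred (hn : PTN sz V n) : PTN sz V (fun a => n a - 1) := by
  simpa [PTN] using PT.tail hn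

theorem const (k : ℕ) : PTN sz V (fun _ => k) := by
  induction k with
  | zero => exact zero
  | succ k ih => exact ih.succ

theorem length (hℓ : PT sz V ℓ) : PTN sz V (fun a => (ℓ a).length) :=
  PT.iterate hℓ (fun _ i => List.replicate i true) PT.nil
    (PolyBdd.size.mono fun p => by simp [szIdx])
    (succ (n := fun p : A × ℕ => p.2) (idx.weaken (Set.subset_insert _ _)))

theorem add (hm : PTN sz V m) (hn : PTN sz V n) : PTN sz V (fun a => m a + n a) := by
  refine iterateN hn (fun a i => m a + i) hm (hm.lift.bdd.add (idx (V := V)).bdd)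
    (succ (n := fun p : A × ℕ => m p.1 + p.2)
      (var (Set.mem_insert _ _) (hm.lift.bdd.add (idx (V := V)).bdd)))

theorem sub (hm : PTN sz V m) (hn : PTN sz V n) : PTN sz V (fun a => m a - n a) := by
  have hb : PolyBdd (szIdx sz) (fun p : A × ℕ => m p.1 - p.2) :=
    hm.lift.bdd.mono fun p => Nat.sub_le _ _
  exact iterateN hn (fun a i => m a - i) hm hb
    (pred (n := fun p : A × ℕ => m p.1 - p.2) (var (Set.mem_insert _ _) hb))

theorem mul (hm : PTN sz V m) (hn : PTN sz V n) : PTN sz V (fun a => m a * n a) := by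
  have hb : PolyBdd (szIdx sz) (fun p : A × ℕ => m p.1 * p.2) := hm.lift.bdd.mul (idx (V := V)).bdd
  exact iterateN hn (fun a i => m a * i) zero hb
    (add (m := fun p : A × ℕ => m p.1 * p.2) (n := fun p : A × ℕ => m p.1)
      (var (Set.mem_insert _ _) hb)
      (hm.lift.weaken (Set.subset_insert _ _)))

theorem sum {e : A × ℕ → ℕ} (hn : PTN sz V n) (he : PTN (szIdx sz) (withIdx V) e) :
    PTN sz V (fun a => ∑ i ∈ Finset.range (n a), e (a, i)) := by
  have hb : PolyBdd (szIdx sz) (fun p : A × ℕ => ∑ i ∈ Finset.range p.2, e (p.1, i)) := by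
    obtain ⟨p, hp⟩ := he.bdd
    refine ((PolyBdd.size (sz := szIdx sz)).mul (PolyBdd.size.eval p)).mono fun q => ?_
    calc _ ≤ ∑ i ∈ Finset.range q.2, p.eval (szIdx sz q) := by
          refine Finset.sum_le_sum fun i hi => (hp _).trans (p.eval_nat_mono ?_)
          rw [Finset.mem_range] at hi
          simp only [szIdx]
          omega
      _ = q.2 * p.eval (szIdx sz q) := by simp
      _ ≤ _ := Nat.mul_le_mul_right _ (by simp [szIdx])
  refine iterateN hn (fun a i => ∑ j ∈ Finset.range i, e (a, j)) zero hb ?_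
  simp only [Finset.sum_range_succ]
  exact add (m := fun p : A × ℕ => ∑ i ∈ Finset.range p.2, e (p.1, i)) (var (Set.mem_insert _ _) hb)
    (he.weaken (Set.subset_insert _ _))

theorem pow (hn : PTN sz V n) (k : ℕ) : PTN sz V (fun a => n a ^ k) := by
  induction k with
  | zero => exact const 1
  | succ k ih => exact ih.mul hn

theorem eval (hn : PTN sz V n) (p : Polynomial ℕ) : PTN sz V (fun a => p.eval (n a)) := by
  induction p using Polynomial.induction_on' with
  | add p q hp hq => simpa using hp.add hq
  | monomial k x => simpa using (const x).mul (hn.pow k)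

end PTN

namespace PTB

theorem congr (hc : PTB sz V c) (h : ∀ a, c a = d a) : PTB sz V d := funext h ▸ hc

theorem weaken (hc : PTB sz V c) (h : V ⊆ W) : PTB sz W c := PT.weaken hc h

theorem const (x : Bool) : PTB sz V (fun _ => x) := PT.cons x PT.nil

theorem ite (hc : PTB sz V c) (hf : PT sz V f) (hg : PT sz V g) :
    PT sz V (fun a => if c a then f a else g a) := by
  convert PT.case hc hf hg hf using 2 with a
  cases c a <;> rfl

theorem iteN (hc : PTB sz V c) (hm : PTN sz V m) (hn : PTN sz V n) :
    PTN sz V (fun a => if c a then m a else n a) := by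
  refine PT.congr (ite hc hm hn) fun a => ?_
  beta_reduce
  cases c a <;> rfl

theorem not (hc : PTB sz V c) : PTB sz V (fun a => !c a) := by
  refine PT.congr (ite hc (const false) (const true)) fun a => ?_
  beta_reduce
  cases c a <;> rfl

theorem and (hc : PTB sz V c) (hd : PTB sz V d) : PTB sz V (fun a => c a && d a) := by
  refine PT.congr (ite hc hd (const false)) fun a => ?_
  beta_reduce
  cases c a <;> rfl

theorem or (hc : PTB sz V c) (hd : PTB sz V d) : PTB sz V (fun a => c a || d a) := by
  refine PT.congr (ite hc (const true) hd) fun a => ?_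
  beta_reduce
  cases c a <;> rfl

theorem xor (hc : PTB sz V c) (hd : PTB sz V d) : PTB sz V (fun a => c a ^^ d a) := by
  refine PT.congr (ite hc hd.not hd) fun a => ?_
  beta_reduce
  cases c a <;> simp

theorem beq (hc : PTB sz V c) (hd : PTB sz V d) : PTB sz V (fun a => c a == d a) := by
  refine PT.congr (ite hc hd hd.not) fun a => ?_
  beta_reduce
  cases c a <;> simp

theorem toNat (hc : PTB sz V c) : PTN sz V (fun a => (c a).toNat) := by
  refine PTN.congr (iteN hc (.const 1) .zero) fun a => ?_
  cases c a <;> rfl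

theorem cons (hc : PTB sz V c) (hf : PT sz V f) : PT sz V (fun a => c a :: f a) := by
  refine PT.congr (ite hc (hf.cons true) (hf.cons false)) fun a => ?_
  cases c a <;> rfl

theorem lt (hm : PTN sz V m) (hn : PTN sz V n) : PTB sz V (fun a => decide (m a < n a)) := by
  refine PT.congr (PT.case (hn.sub hm) (const false) (const true) (const true)) fun a => ?_
  by_cases h : m a < n a
  · obtain ⟨k, hk⟩ : ∃ k, n a - m a = k + 1 := ⟨n a - m a - 1, by omega⟩
    simp [h, hk, List.replicate_succ]
  · have : n a - m a = 0 := by omega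
    simp [h, this]

theorem le (hm : PTN sz V m) (hn : PTN sz V n) : PTB sz V (fun a => decide (m a ≤ n a)) := by
  simpa only [← not_lt, decide_not] using (lt hn hm).not

theorem eq (hm : PTN sz V m) (hn : PTN sz V n) : PTB sz V (fun a => decide (m a = n a)) := by
  refine congr ((le hm hn).and (le hn hm)) fun a => ?_
  simp [← Bool.decide_and, Nat.le_antisymm_iff]

theorem getD (hℓ : PT sz V ℓ) (hn : PTN sz V n) : PTB sz V (fun a => (ℓ a).getD (n a) false) := by
  have hb : PolyBdd (szIdx sz) (fun p : A × ℕ => ((ℓ p.1).drop p.2).length) :=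
    hℓ.lift.bdd.mono fun p => by simp
  have hd : PT sz V (fun a => (ℓ a).drop (n a)) := by
    refine PTN.iterate hn (fun a i => (ℓ a).drop i) (by simpa using hℓ) hb ?_
    refine PT.congr (PT.tail (PT.var (Set.mem_insert _ _) hb)) fun p => ?_
    simp
  refine PT.congr (PT.case hd (const false) (const false) (const true)) fun a => ?_
  beta_reduce
  rw [List.getD_eq_getElem?_getD, ← List.head?_drop]
  rcases (ℓ a).drop (n a) with _ | ⟨_ | _, l⟩ <;> rfl

theorem forall_lt {e : A × ℕ → Bool} (hn : PTN sz V n) (he : PTB (szIdx sz) (withIdx V) e) :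
    PTB sz V (fun a => decide (∀ i < n a, e (a, i) = true)) := by
  refine congr (eq (hn.sum he.not.toNat) .zero) fun a => ?_
  rw [decide_eq_decide]
  simp [Finset.sum_eq_zero_iff]

theorem subst {e : A × ℕ → Bool} (he : PTB (szIdx sz) (withIdx V) e) (hn : PTN sz V n) :
    PTB sz V (fun a => e (a, n a)) := PTN.subst he hn

theorem var (h : (fun a => [c a]) ∈ V) : PTB sz V c :=
  PT.var h ((PolyBdd.const 1).mono fun a => by simp)

/-- Iteration with a bit as the state. -/
theorem iterate (hn : PTN sz V n) (acc : A → ℕ → Bool) (h₀ : PTB sz V (fun a => acc a 0))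
    (hs : PTB (szIdx sz) (insert (fun p => [acc p.1 p.2]) (withIdx V))
      (fun p => acc p.1 (p.2 + 1))) :
    PTB sz V (fun a => acc a (n a)) :=
  PTN.iterate hn (fun a i => [acc a i]) h₀ ((PolyBdd.const 1).mono fun a => by simp) hs

theorem odd (hn : PTN sz V n) : PTB sz V (fun a => decide (n a % 2 = 1)) := by
  refine iterate hn (fun _ i => decide (i % 2 = 1)) (const false) ?_
  refine congr (not (c := fun p : A × ℕ => decide (p.2 % 2 = 1)) (var (Set.mem_insert _ _)))
    fun p => ?_
  rw [← decide_not, decide_eq_decide]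
  omega

end PTB

namespace PTN

theorem half (hn : PTN sz V n) : PTN sz V (fun a => n a / 2) := by
  have hb : PolyBdd (szIdx sz) (fun p : A × ℕ => p.2 / 2) :=
    PolyBdd.size.mono fun p => (Nat.div_le_self _ _).trans (by simp [szIdx])
  have hv : PTN (szIdx sz) (insert (fun p : A × ℕ => List.replicate (p.2 / 2) true) (withIdx V))
    (fun p => p.2 / 2) := var (Set.mem_insert _ _) hb
  refine iterateN hn (fun _ i => i / 2) zero hb ?_
  -- Counting up to n, the half grows exactly when the counter leaves an odd number.
  refine congr (PTB.iteN (PTB.odd (idx.weaken (Set.subset_insert _ _))) hv.succ hv) fun p => ?_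
  simp only [decide_eq_true_eq]
  split_ifs <;> omega

theorem div_two_pow (hm : PTN sz V m) (hn : PTN sz V n) : PTN sz V (fun a => m a / 2 ^ n a) := by
  have hb : PolyBdd (szIdx sz) (fun p : A × ℕ => m p.1 / 2 ^ p.2) :=
    hm.lift.bdd.mono fun p => Nat.div_le_self _ _
  refine iterateN hn (fun a i => m a / 2 ^ i) (by simpa using hm) hb ?_
  refine congr (half (n := fun p : A × ℕ => m p.1 / 2 ^ p.2) (var (Set.mem_insert _ _) hb))
    fun p => ?_
  rw [pow_succ, Nat.div_div_eq_div_mul]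

theorem two_pow (hn : PTN sz V n) (hb : PolyBdd sz (fun a => 2 ^ n a)) :
    PTN sz V (fun a => 2 ^ n a) := by
  -- Repeated doubling is frozen at exponent n a, because the state has to be polynomially bounded
  -- at every index.
  have hb' : PolyBdd (szIdx sz) (fun p : A × ℕ => 2 ^ min p.2 (n p.1)) :=
    (hb.lift Prod.fst (PolyBdd.size.mono fun p => by simp [szIdx])).mono fun p =>
      Nat.pow_le_pow_right two_pos (min_le_right _ _)
  have hv : PTN (szIdx sz) (insert (fun p : A × ℕ => List.replicate (2 ^ min p.2 (n p.1)) true)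
    (withIdx V)) (fun p => 2 ^ min p.2 (n p.1)) := var (Set.mem_insert _ _) hb'
  have := iterateN hn (fun a i => 2 ^ min i (n a)) (by simpa using const 1) hb' (by
    refine congr (PTB.iteN (PTB.lt (idx.weaken (Set.subset_insert _ _))
      (hn.lift.weaken (Set.subset_insert _ _))) (hv.add hv) hv) fun p => ?_
    simp only [decide_eq_true_eq]
    split_ifs with h
    · rw [min_eq_left (by omega), min_eq_left (by omega), pow_succ]; ring
    · rw [min_eq_right (by omega), min_eq_right (by omega)])
  simpa using this

end PTN

theorem PTB.testBit (hm : PTN sz V m) (hn : PTN sz V n) :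
    PTB sz V (fun a => (m a).testBit (n a)) := by
  simpa only [Nat.testBit_eq_decide_div_mod_eq] using PTB.odd (hm.div_two_pow hn)

/-- Bits can only be pushed in front, so the list is built from its last entry to its first. -/
theorem PT.map_range {e : A × ℕ → Bool} (hn : PTN sz V n) (he : PTB (szIdx sz) (withIdx V) e) :
    PT sz V (fun a => (List.range (n a)).map fun i => e (a, i)) := by
  let acc : A → ℕ → List Bool := fun a i =>
    Nat.rec [] (fun i l => e (a, n a - 1 - i) :: l) i
  have hlen : ∀ a i, (acc a i).length = i := by
    intro a i
    induction i with
    | zero => rfl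
    | succ i ih => simpa [acc] using ih
  have hb : PolyBdd (szIdx sz) (fun p : A × ℕ => (acc p.1 p.2).length) :=
    PolyBdd.size.mono fun p => by rw [hlen]; simp [szIdx]
  have hstep : PTB (szIdx sz) (withIdx V) (fun p => e (p.1, n p.1 - 1 - p.2)) := by
    have h₁ : PTN (szIdx sz) (withIdx V) (fun p => n p.1 - 1 - p.2) := hn.lift.pred.sub .idx
    have h₂ : PTB (szIdx (szIdx sz)) (withIdx (withIdx V))
        (fun q : (A × ℕ) × ℕ => e (q.1.1, q.2)) := by
      refine PT.comp he (fun q : (A × ℕ) × ℕ => (q.1.1, q.2)) (PolyBdd.size.mono fun q => ?_) ?_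
      · simp only [szIdx]; omega
      · rintro v (rfl | ⟨w, hw, rfl⟩)
        · exact .inl rfl
        · exact .inr ⟨fun p => w p.1, .inr ⟨w, hw, rfl⟩, rfl⟩
    exact h₂.subst h₁
  have key := PTN.iterate hn acc PT.nil hb
    (PTB.cons (hstep.weaken (Set.subset_insert _ _)) (.var (Set.mem_insert _ _) hb))
  refine PT.congr key fun a => ?_
  have : ∀ i ≤ n a, acc a i = (List.range' (n a - i) i).map fun i => e (a, i) := by
    intro i hi
    induction i with
    | zero => rfl
    | succ i ih =>
      have : acc a (i + 1) = e (a, n a - 1 - i) :: acc a i := rfl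
      rw [this, ih (by omega), List.range'_succ, List.map_cons,
        show n a - (i + 1) + 1 = n a - i by omega, show n a - (i + 1) = n a - 1 - i by omega]
  rw [this _ le_rfl, Nat.sub_self, List.range_eq_range']

end

/-! ### The sampling algorithm on lists and numbers -/

/-- The bits of a circuit description: gate `g`, wire `j`, control (`k = 0`) or target (`k = 1`). -/
def gateBit (desc : List Bool) (N g j k : ℕ) : Bool := desc.getD (N + 1 + (g * N + j) * 2 + k) false

/-- Apply the gate number `g` of a described circuit. -/
def simStep (desc : List Bool) (N : ℕ) (w : List Bool) (g : ℕ) : List Bool :=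
  (List.range N).map fun i => w.getD i false ^^ (gateBit desc N g i 1 &&
    decide (∀ j < N, (!gateBit desc N g j 0 || w.getD j false) = true))

/-- Apply the first gates of a described circuit. -/
def simForward (desc : List Bool) (N : ℕ) (w : List Bool) : ℕ → List Bool
  | 0 => w
  | g + 1 => simStep desc N (simForward desc N w g) g

/-- Apply the gates numbered `G - 1, G - 2, …` of a described circuit. -/
def simBackward (desc : List Bool) (N G : ℕ) (w : List Bool) : ℕ → List Bool
  | 0 => w
  | g + 1 => simStep desc N (simBackward desc N G w g) (G - 1 - g)

/-- The number of selected wires before wire `i`. -/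
def rank (M : List Bool) (i : ℕ) : ℕ := ∑ j ∈ Finset.range i, (M.getD j false).toNat

/-- The bit at wire `i` of the assignment to the selected wires that has the number `z`. -/
def wireBit (M : List Bool) (z i : ℕ) : Bool := z.testBit (rank M i)

/-- The `t`-th random input of the circuit. -/
def inputBlock (ρ : List Bool) (N t : ℕ) : List Bool :=
  (List.range N).map fun i => decide (i + 1 < N) && ρ.getD (i + N * t) false

/-- Add the assignment number `a` to the selected wires of `y`. -/
def flipWires (M : List Bool) (N a : ℕ) (y : List Bool) : List Bool :=
  (List.range N).map fun i => y.getD i false ^^ (M.getD i false && wireBit M a i)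

/-- Whether the pair of `x` and the assignment `a` contributes to the weight of `z`. -/
def contributes (desc : List Bool) (N : ℕ) (M x : List Bool) (a z : ℕ) : Bool :=
  (!(simBackward desc N desc.length (flipWires M N a (simForward desc N x desc.length))
      desc.length).getD (N - 1) false &&
    !(M.getD (N - 1) false && wireBit M a (N - 1))) &&
  (!M.getD (N - 1) false ||
    ((simForward desc N x desc.length).getD (N - 1) false == wireBit M z (N - 1)))

/-- The sign of a contribution. -/
def signBit (M : List Bool) (N a z : ℕ) : Bool :=
  decide ((∑ i ∈ Finset.range N,
    (M.getD i false && (wireBit M a i && wireBit M z i)).toNat) % 2 = 1)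

/-- The number of contributions with a given sign. -/
def tally (desc : List Bool) (N : ℕ) (M ρ : List Bool) (T K : ℕ) (sign : Bool) (z : ℕ) : ℕ :=
  ∑ t ∈ Finset.range T, ∑ a ∈ Finset.range K,
    (contributes desc N M (inputBlock ρ N t) a z && (signBit M N a z == sign)).toNat

/-- The weight of `z`, cut off at zero. -/
def weight (desc : List Bool) (N : ℕ) (M ρ : List Bool) (T K z : ℕ) : ℕ :=
  tally desc N M ρ T K false z - tally desc N M ρ T K true z

/-- Partial sums of the weights. -/
def cumWeight (desc : List Bool) (N : ℕ) (M ρ : List Bool) (T K z : ℕ) : ℕ :=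
  ∑ y ∈ Finset.range z, weight desc N M ρ T K y

/-- The number with the `J` binary digits at position `o` of `ρ`, modulo `S`. -/
def digitsMod (ρ : List Bool) (o J S : ℕ) : ℕ → ℕ
  | 0 => 0
  | j + 1 =>
    let u := 2 * digitsMod ρ o J S j + (ρ.getD (o + (J - 1 - j)) false).toNat
    if u < S then u else u - S

/-- The number of the assignment that is sampled. -/
def selected (desc : List Bool) (N : ℕ) (M ρ : List Bool) (T J K : ℕ) : ℕ :=
  ∑ z ∈ Finset.range K, (decide (cumWeight desc N M ρ T K (z + 1) ≤
    digitsMod ρ (N * T) J (cumWeight desc N M ρ T K K) J)).toNat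

/-! ### The sampling algorithm runs in polynomial time. -/

section

variable {A : Type*} {sz : A → ℕ} {V : Set (A → List Bool)} {desc w M ρ x : A → List Bool}
  {N G T J K S a g i j o t z : A → ℕ}

theorem PTB.gateBit (hdesc : PT sz V desc) (hN : PTN sz V N) (hg : PTN sz V g)
    (hj : PTN sz V j) (k : ℕ) :
    PTB sz V (fun x => gateBit (desc x) (N x) (g x) (j x) k) :=
  .getD hdesc ((((hN.add (.const 1)).add (((hg.mul hN).add hj).mul (.const 2)))).add (.const k))

theorem length_simStep (desc : List Bool) (N : ℕ) (w : List Bool) (g : ℕ) :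
    (simStep desc N w g).length = N := by simp [simStep]

theorem PT.simStep (hdesc : PT sz V desc) (hN : PTN sz V N) (hw : PT sz V w) (hg : PTN sz V g) :
    PT sz V (fun x => simStep (desc x) (N x) (w x) (g x)) := by
  refine PT.map_range (e := fun p => (w p.1).getD p.2 false ^^
    (_root_.gateBit (desc p.1) (N p.1) (g p.1) p.2 1 && decide (∀ j < N p.1,
      (!_root_.gateBit (desc p.1) (N p.1) (g p.1) j 0 || (w p.1).getD j false) = true))) hN ?_
  refine (PTB.getD hw.lift .idx).xor ((PTB.gateBit hdesc.lift hN.lift hg.lift .idx 1).and ?_)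
  refine PTB.forall_lt (e := fun p => (!_root_.gateBit (desc p.1.1) (N p.1.1) (g p.1.1) p.2 0 ||
    (w p.1.1).getD p.2 false)) hN.lift ?_
  exact (PTB.gateBit hdesc.lift.lift hN.lift.lift hg.lift.lift .idx 0).not.or
    (PTB.getD hw.lift.lift .idx)

theorem length_simForward_le (desc : List Bool) (N : ℕ) (w : List Bool) (g : ℕ) :
    (simForward desc N w g).length ≤ N + w.length := by
  cases g <;> simp [simForward, length_simStep]

theorem length_simBackward_le (desc : List Bool) (N G : ℕ) (w : List Bool) (g : ℕ) :
    (simBackward desc N G w g).length ≤ N + w.length := by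
  cases g <;> simp [simBackward, length_simStep]

theorem PT.simForward (hdesc : PT sz V desc) (hN : PTN sz V N) (hw : PT sz V w)
    (hg : PTN sz V g) : PT sz V (fun x => simForward (desc x) (N x) (w x) (g x)) := by
  have hb : PolyBdd (PT.szIdx sz)
      (fun p : A × ℕ => (_root_.simForward (desc p.1) (N p.1) (w p.1) p.2).length) :=
    (hN.lift.bdd.add hw.lift.bdd).mono fun p => length_simForward_le _ _ _ _
  exact PTN.iterate hg (fun x g => _root_.simForward (desc x) (N x) (w x) g) hw hb
    (PT.simStep (hdesc.lift.weaken (Set.subset_insert _ _))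
      (hN.lift.weaken (Set.subset_insert _ _)) (.var (Set.mem_insert _ _) hb)
      (PTN.idx.weaken (Set.subset_insert _ _)))

theorem PT.simBackward (hdesc : PT sz V desc) (hN : PTN sz V N) (hG : PTN sz V G)
    (hw : PT sz V w) (hg : PTN sz V g) :
    PT sz V (fun x => simBackward (desc x) (N x) (G x) (w x) (g x)) := by
  have hb : PolyBdd (PT.szIdx sz)
      (fun p : A × ℕ => (_root_.simBackward (desc p.1) (N p.1) (G p.1) (w p.1) p.2).length) :=
    (hN.lift.bdd.add hw.lift.bdd).mono fun p => length_simBackward_le _ _ _ _ _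
  exact PTN.iterate hg (fun x g => _root_.simBackward (desc x) (N x) (G x) (w x) g) hw hb
    (PT.simStep (hdesc.lift.weaken (Set.subset_insert _ _))
      (hN.lift.weaken (Set.subset_insert _ _)) (.var (Set.mem_insert _ _) hb)
      ((hG.lift.pred.sub .idx).weaken (Set.subset_insert _ _)))

theorem PTN.rank (hM : PT sz V M) (hi : PTN sz V i) : PTN sz V (fun x => rank (M x) (i x)) :=
  PTN.sum (e := fun p => ((M p.1).getD p.2 false).toNat) hi (PTB.getD hM.lift .idx).toNat

theorem PTB.wireBit (hM : PT sz V M) (hz : PTN sz V z) (hi : PTN sz V i) :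
    PTB sz V (fun x => wireBit (M x) (z x) (i x)) := .testBit hz (.rank hM hi)

theorem PT.inputBlock (hρ : PT sz V ρ) (hN : PTN sz V N) (ht : PTN sz V t) :
    PT sz V (fun x => inputBlock (ρ x) (N x) (t x)) :=
  PT.map_range (e := fun p => decide (p.2 + 1 < N p.1) && (ρ p.1).getD (p.2 + N p.1 * t p.1) false)
    hN ((PTB.lt PTN.idx.succ hN.lift).and (.getD hρ.lift (PTN.idx.add (hN.lift.mul ht.lift))))

theorem PT.flipWires (hM : PT sz V M) (hN : PTN sz V N) (ha : PTN sz V a) (hw : PT sz V w) :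
    PT sz V (fun x => flipWires (M x) (N x) (a x) (w x)) :=
  PT.map_range (e := fun p => (w p.1).getD p.2 false ^^
    ((M p.1).getD p.2 false && _root_.wireBit (M p.1) (a p.1) p.2)) hN
    ((PTB.getD hw.lift .idx).xor ((PTB.getD hM.lift .idx).and (.wireBit hM.lift ha.lift .idx)))

theorem PTB.contributes (hdesc : PT sz V desc) (hN : PTN sz V N) (hM : PT sz V M)
    (hx : PT sz V x) (ha : PTN sz V a) (hz : PTN sz V z) :
    PTB sz V (fun p => contributes (desc p) (N p) (M p) (x p) (a p) (z p)) := by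
  have hy := PT.simForward hdesc hN hx (.length hdesc)
  have hu := PT.simBackward hdesc hN (.length hdesc) (.flipWires hM hN ha hy) (.length hdesc)
  have hl := PTB.getD hM hN.pred
  have h₁ := (PTB.getD hu hN.pred).not.and (hl.and (.wireBit hM ha hN.pred)).not
  have h₂ := hl.not.or ((PTB.getD hy hN.pred).beq (.wireBit hM hz hN.pred))
  exact (h₁.and h₂).congr fun _ => rfl

theorem PTB.signBit (hM : PT sz V M) (hN : PTN sz V N) (ha : PTN sz V a) (hz : PTN sz V z) :
    PTB sz V (fun x => signBit (M x) (N x) (a x) (z x)) :=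
  PTB.odd (PTN.sum (e := fun p => ((M p.1).getD p.2 false &&
    (_root_.wireBit (M p.1) (a p.1) p.2 && _root_.wireBit (M p.1) (z p.1) p.2)).toNat) hN
    ((PTB.getD hM.lift .idx).and ((PTB.wireBit hM.lift ha.lift .idx).and
      (.wireBit hM.lift hz.lift .idx))).toNat)

theorem PTN.tally (hdesc : PT sz V desc) (hN : PTN sz V N) (hM : PT sz V M) (hρ : PT sz V ρ)
    (hT : PTN sz V T) (hK : PTN sz V K) (sign : Bool) (hz : PTN sz V z) :
    PTN sz V (fun p => tally (desc p) (N p) (M p) (ρ p) (T p) (K p) sign (z p)) := by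
  have h₁ : PTB (PT.szIdx (PT.szIdx sz)) (PT.withIdx (PT.withIdx V))
      (fun p => _root_.contributes (desc p.1.1) (N p.1.1) (M p.1.1)
        (_root_.inputBlock (ρ p.1.1) (N p.1.1) p.1.2) p.2 (z p.1.1)) :=
    PTB.contributes hdesc.lift.lift hN.lift.lift hM.lift.lift
      (PT.lift (.inputBlock hρ.lift hN.lift .idx)) .idx hz.lift.lift
  have h₂ : PTB (PT.szIdx (PT.szIdx sz)) (PT.withIdx (PT.withIdx V))
      (fun p => _root_.signBit (M p.1.1) (N p.1.1) p.2 (z p.1.1)) :=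
    PTB.signBit hM.lift.lift hN.lift.lift .idx hz.lift.lift
  exact PTN.sum hT (PTN.sum hK.lift (h₁.and (h₂.beq (.const sign))).toNat)

theorem PTN.cumWeight (hdesc : PT sz V desc) (hN : PTN sz V N) (hM : PT sz V M) (hρ : PT sz V ρ)
    (hT : PTN sz V T) (hK : PTN sz V K) (hz : PTN sz V z) :
    PTN sz V (fun p => cumWeight (desc p) (N p) (M p) (ρ p) (T p) (K p) (z p)) :=
  PTN.sum (e := fun p => weight (desc p.1) (N p.1) (M p.1) (ρ p.1) (T p.1) (K p.1) p.2) hz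
    (.sub (.tally hdesc.lift hN.lift hM.lift hρ.lift hT.lift hK.lift false .idx)
      (.tally hdesc.lift hN.lift hM.lift hρ.lift hT.lift hK.lift true .idx))

theorem digitsMod_lt (ρ : List Bool) (o J : ℕ) {S : ℕ} (hS : 0 < S) (j : ℕ) :
    digitsMod ρ o J S j < S := by
  induction j with
  | zero => exact hS
  | succ j ih =>
    have := Bool.toNat_le (ρ.getD (o + (J - 1 - j)) false)
    simp only [digitsMod]
    split_ifs <;> omega

/-- A J-bit number would be too long in unary. Reducing after each digit keeps the state below S,
and this needs S to be positive. -/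
theorem PTN.digitsMod (hρ : PT sz V ρ) (ho : PTN sz V o) (hJ : PTN sz V J) (hS : PTN sz V S)
    (hS₀ : ∀ x, 0 < S x) (hj : PTN sz V j) :
    PTN sz V (fun p => digitsMod (ρ p) (o p) (J p) (S p) (j p)) := by
  have hb : PolyBdd (PT.szIdx sz)
      (fun p : A × ℕ => _root_.digitsMod (ρ p.1) (o p.1) (J p.1) (S p.1) p.2) :=
    hS.lift.bdd.mono fun p => (digitsMod_lt _ _ _ (hS₀ p.1) _).le
  refine iterateN hj (fun p j => _root_.digitsMod (ρ p) (o p) (J p) (S p) j) .zero hb ?_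
  have hu : PTN (PT.szIdx sz) (insert (fun p : A × ℕ =>
      List.replicate (_root_.digitsMod (ρ p.1) (o p.1) (J p.1) (S p.1) p.2) true) (PT.withIdx V))
      (fun p => 2 * _root_.digitsMod (ρ p.1) (o p.1) (J p.1) (S p.1) p.2 +
        ((ρ p.1).getD (o p.1 + (J p.1 - 1 - p.2)) false).toNat) :=
    ((PTN.const 2).mul (.var (Set.mem_insert _ _) hb)).add
      ((PTB.getD hρ.lift (ho.lift.add (hJ.lift.pred.sub .idx))).toNat.weaken
        (Set.subset_insert _ _))
  have hS' := hS.lift.weaken (Set.subset_insert (fun p : A × ℕ =>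
      List.replicate (_root_.digitsMod (ρ p.1) (o p.1) (J p.1) (S p.1) p.2) true) (PT.withIdx V))
  refine congr (PTB.iteN (PTB.lt hu hS') hu (hu.sub hS')) fun p => ?_
  simp [_root_.digitsMod]

theorem PTN.selected (hdesc : PT sz V desc) (hN : PTN sz V N) (hM : PT sz V M) (hρ : PT sz V ρ)
    (hT : PTN sz V T) (hJ : PTN sz V J) (hK : PTN sz V K)
    (hS : ∀ p, 0 < _root_.cumWeight (desc p) (N p) (M p) (ρ p) (T p) (K p) (K p)) :
    PTN sz V (fun p => selected (desc p) (N p) (M p) (ρ p) (T p) (J p) (K p)) := by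
  have hv := PTN.digitsMod hρ (hN.mul hT) hJ (.cumWeight hdesc hN hM hρ hT hK hK) hS hJ
  exact PTN.sum (e := fun p => (decide (_root_.cumWeight (desc p.1) (N p.1) (M p.1) (ρ p.1)
    (T p.1) (K p.1) (p.2 + 1) ≤ _root_.digitsMod (ρ p.1) (N p.1 * T p.1) (J p.1)
      (_root_.cumWeight (desc p.1) (N p.1) (M p.1) (ρ p.1) (T p.1) (K p.1) (K p.1))
        (J p.1))).toNat) hK
    (PTB.le (.cumWeight hdesc.lift hN.lift hM.lift hρ.lift hT.lift hK.lift PTN.idx.succ)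
      hv.lift).toNat

theorem PT.testBits (hz : PTN sz V z) (hn : PTN sz V N) :
    PT sz V (fun p => (List.range (N p)).map fun j => (z p).testBit j) :=
  PT.map_range (e := fun p => (z p.1).testBit p.2) hn (.testBit hz.lift .idx)

end

/-! ### The output distribution as a mean of quasi-probabilities -/

/-- An assignment to the wires in `M`, extended by `false`. -/
def extendFalse {N : ℕ} {M : Finset (Fin N)} (α : M → Bool) (i : Fin N) : Bool :=
  if h : i ∈ M then α ⟨i, h⟩ else false

/-- The character `(-1)^{α·ζ}`. -/
def charSign {N : ℕ} {M : Finset (Fin N)} (α ζ : M → Bool) : ℤ :=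
  ∏ i, if extendFalse α i && extendFalse ζ i then -1 else 1

/-- Whether `α` contributes to the quasi-probability of `ζ` at the input `x` of the permutation `π`;
`l` is the wire without Hadamard gate. -/
def Contributes {N : ℕ} (π : Equiv.Perm (Fin N → Bool)) (l : Fin N) (M : Finset (Fin N))
    (x : Fin N → Bool) (α ζ : M → Bool) : Prop :=
  (π.symm fun i => π x i ^^ extendFalse α i) l = false ∧ extendFalse α l = false ∧
    (l ∈ M → π x l = extendFalse ζ l)

instance {N : ℕ} (π : Equiv.Perm (Fin N → Bool)) (l : Fin N) (M : Finset (Fin N))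
    (x : Fin N → Bool) (α ζ : M → Bool) : Decidable (Contributes π l M x α ζ) := by
  unfold Contributes; infer_instance

/-- The quasi-probability of `ζ` at the input `x`, without normalization. -/
def quasiWeight {N : ℕ} (π : Equiv.Perm (Fin N → Bool)) (l : Fin N) (M : Finset (Fin N))
    (x : Fin N → Bool) (ζ : M → Bool) : ℤ :=
  ∑ α : M → Bool, if Contributes π l M x α ζ then charSign α ζ else 0

/-- The entry of the Hadamard layer at one wire. -/
noncomputable def layerEntry {N : ℕ} (l i : Fin N) (a b : Bool) : ℝ :=
  if i = l then (if a = b then 1 else 0) else (if a && b then -1 else 1) / √2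

theorem hadamardLayer_apply {N : ℕ} {l : Fin N} (hl : (l : ℕ) + 1 = N) (a b : Fin N → Bool) :
    hadamardLayer N a b = ((∏ i, layerEntry l i (a i) (b i) : ℝ) : ℂ) := by
  simp only [hadamardLayer, Matrix.of_apply, Complex.ofReal_prod]
  refine Finset.prod_congr rfl fun i _ => ?_
  have : (i : ℕ) + 1 = N ↔ i = l := by rw [Fin.ext_iff]; omega
  simp only [this, layerEntry]
  by_cases h : i = l
  · simp only [h, if_true, Matrix.one_apply]
    split_ifs <;> simp
  · simp only [h, if_false]
    cases a i <;> cases b i <;> simp [hadamard]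

/-- All amplitudes are real, so squared norms become ordinary squares and no conjugates appear. -/
theorem hc1qState_eq {N : ℕ} {l : Fin N} (hl : (l : ℕ) + 1 = N) (C : RevCircuit N)
    (w : Fin N → Bool) :
    hc1qState C w = ((∑ x, (∏ i, layerEntry l i (w i) (C.perm x i)) *
      ∏ i, layerEntry l i (x i) false : ℝ) : ℂ) := by
  have h₁ : ∀ x, (hadamardLayer N * coherent C.perm) w x = hadamardLayer N w (C.perm x) := by
    intro x
    simp [Matrix.mul_apply, coherent]
  simp only [hc1qState, Matrix.mulVec_single_one, Matrix.col_apply, Matrix.mul_apply (M := _ * _),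
    h₁, hadamardLayer_apply hl]
  push_cast
  rfl

theorem prod_layerEntry_false {N : ℕ} {l : Fin N} (hl : (l : ℕ) + 1 = N) (x : Fin N → Bool) :
    ∏ i, layerEntry l i (x i) false = (if x l = false then 1 else 0) * (1 / √2) ^ (N - 1) := by
  have : ∀ i, layerEntry l i (x i) false = (if i = l then (if x l = false then 1 else 0) else 1) *
      (if i ∈ Finset.univ.erase l then 1 / √2 else 1) := by
    intro i
    by_cases h : i = l
    · subst h; simp [layerEntry]
    · simp [layerEntry, h]
  simp only [this, Finset.prod_mul_distrib, Finset.prod_ite_eq', Finset.prod_ite_mem,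
    Finset.mem_univ, if_true, Finset.univ_inter, Finset.prod_const,
    Finset.card_erase_of_mem (Finset.mem_univ l), Finset.card_univ, Fintype.card_fin]

/-- The signs multiply to (-1)^(ab) (-1)^(a(b+c)) = (-1)^(ac), so the dependence on b cancels. -/
theorem layerEntry_mul_xor {N : ℕ} {l i : Fin N} (h : i ≠ l) (a b c : Bool) :
    layerEntry l i a b * layerEntry l i a (b ^^ c) = 1 / 2 * if c && a then -1 else 1 := by
  have h2 : (1 / √2 : ℝ) * (1 / √2) = 1 / 2 := by
    rw [← mul_div_mul_comm, one_mul, Real.mul_self_sqrt (by norm_num)]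
  have h3 : (√2 : ℝ) ≠ 0 := by positivity
  have h4 : (√2 : ℝ) * √2 = 2 := Real.mul_self_sqrt (by norm_num)
  cases a <;> cases b <;> cases c <;> simp [layerEntry, h] <;> field_simp <;> nlinarith

/-- The sum over all outcomes compatible with `ζ` of a product of two entries. -/
theorem sum_layer_mul_layer {N : ℕ} {l : Fin N} {M : Finset (Fin N)} (ζ : M → Bool)
    (u e : Fin N → Bool) :
    ∑ w : Fin N → Bool, (if ∀ i : M, w i = ζ i then
      (∏ i, layerEntry l i (w i) (u i)) * ∏ i, layerEntry l i (w i) (u i ^^ e i) else 0) =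
    ∏ i, ∑ b : Bool, if ∀ h : i ∈ M, b = ζ ⟨i, h⟩ then
      layerEntry l i b (u i) * layerEntry l i b (u i ^^ e i) else 0 := by
  rw [Finset.prod_univ_sum, Fintype.piFinset_univ]
  refine Finset.sum_congr rfl fun w _ => ?_
  rw [Finset.prod_ite_zero, Finset.prod_mul_distrib]
  simp only [Finset.mem_univ, true_imp_iff, Subtype.forall]

/-- Orthonormality of the columns of the one-wire matrix; this is what tracing out an unmeasured
wire uses. -/
theorem sum_layerEntry_not_mem {N : ℕ} {l i : Fin N} (c e : Bool) :
    ∑ b : Bool, layerEntry l i b c * layerEntry l i b (c ^^ e) = if e then 0 else 1 := by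
  by_cases h : i = l
  · subst h
    cases c <;> cases e <;> simp [layerEntry]
  · simp only [layerEntry_mul_xor h]
    cases e <;> norm_num

theorem sum_layer_of_notMem {N : ℕ} {l : Fin N} {M : Finset (Fin N)} (ζ : M → Bool)
    (u e : Fin N → Bool) (he : ∃ i, i ∉ M ∧ e i = true) :
    ∏ i, ∑ b : Bool, (if ∀ h : i ∈ M, b = ζ ⟨i, h⟩ then
      layerEntry l i b (u i) * layerEntry l i b (u i ^^ e i) else 0) = 0 := by
  obtain ⟨i, hi, hei⟩ := he
  refine Finset.prod_eq_zero (Finset.mem_univ i) ?_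
  have := sum_layerEntry_not_mem (l := l) (i := i) (u i) (e i)
  rw [hei] at this
  simpa only [hi, IsEmpty.forall_iff, if_true, hei] using this

/-- Wire by wire: a measured Hadamard wire gives 1/2 and a sign, an unmeasured wire gives 1, and
wire l gives the indicator in the condition. -/
theorem sum_layer_extendFalse {N : ℕ} {l : Fin N} {M : Finset (Fin N)} (ζ α : M → Bool)
    (u : Fin N → Bool) :
    ∏ i, ∑ b : Bool, (if ∀ h : i ∈ M, b = ζ ⟨i, h⟩ then
      layerEntry l i b (u i) * layerEntry l i b (u i ^^ extendFalse α i) else 0) =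
    (1 / 2) ^ (M.erase l).card * (if extendFalse α l = false ∧ (l ∈ M → u l = extendFalse ζ l) then
      (charSign α ζ : ℝ) else 0) := by
  have key : ∀ i, (∑ b : Bool, (if ∀ h : i ∈ M, b = ζ ⟨i, h⟩ then
      layerEntry l i b (u i) * layerEntry l i b (u i ^^ extendFalse α i) else 0)) =
      (if i ∈ M.erase l then 1 / 2 else 1) *
        (if i = l then (if extendFalse α l = false ∧ (l ∈ M → u l = extendFalse ζ l) then 1 else 0)
          else 1) * (if extendFalse α i && extendFalse ζ i then -1 else 1) := by
    intro i
    by_cases hi : i ∈ M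
    · have e₁ : ∀ b, (∀ h : i ∈ M, b = ζ ⟨i, h⟩) ↔ b = ζ ⟨i, hi⟩ :=
        fun b => ⟨fun h => h hi, fun h _ => h⟩
      have e₂ : extendFalse ζ i = ζ ⟨i, hi⟩ := by simp [extendFalse, hi]
      simp only [e₁, Finset.sum_ite_eq', Finset.mem_univ, if_true]
      by_cases h : i = l
      · subst h
        simp only [layerEntry, if_true, e₂, hi, true_imp_iff]
        generalize ζ ⟨i, hi⟩ = a
        generalize extendFalse α i = b
        generalize u i = c
        cases a <;> cases b <;> cases c <;> simp
      · simp [layerEntry_mul_xor h, h, hi, e₂]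
    · have e₁ : extendFalse α i = false := by simp [extendFalse, hi]
      have := sum_layerEntry_not_mem (l := l) (i := i) (u i) (extendFalse α i)
      simp only [hi, IsEmpty.forall_iff, if_true, this]
      by_cases h : i = l
      · subst h; simp [e₁, hi]
      · simp [e₁, h, hi]
  simp only [key, Finset.prod_mul_distrib, Finset.prod_ite_eq', Finset.prod_ite_mem,
    Finset.mem_univ, if_true, Finset.univ_inter, Finset.prod_const, charSign]
  push_cast
  split_ifs <;> simp

theorem extendFalse_injective {N : ℕ} {M : Finset (Fin N)} :
    Function.Injective (extendFalse : (M → Bool) → Fin N → Bool) := by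
  intro α β h
  funext i
  have := congrFun h i
  simpa [extendFalse] using this

/-- Clearing bit l is two-to-one onto the strings with that bit false. It allows sampling from all
strings of N bits. -/
theorem sum_update_false {N : ℕ} (l : Fin N) (f : (Fin N → Bool) → ℝ) :
    ∑ x, f (Function.update x l false) = 2 * ∑ x, if x l = false then f x else 0 := by
  have h₁ : ∑ x, f (Function.update x l false) =
      ∑ x, (if x l = false then f x else 0) +
        ∑ x, if x l = true then f (Function.update x l false) else 0 := by
    rw [← Finset.sum_add_distrib]
    refine Finset.sum_congr rfl fun x _ => ?_
    cases h : x l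
    · simp [← h]
    · simp
  let g : Equiv.Perm (Fin N → Bool) := Function.Involutive.toPerm
    (fun x => Function.update x l (!x l)) (fun x => by simp)
  have h₂ : (∑ x, if x l = true then f (Function.update x l false) else 0) =
      ∑ x, if x l = false then f x else 0 := by
    refine Fintype.sum_equiv g _ _ fun x => ?_
    cases h : x l <;> simp [g, Function.Involutive.toPerm, h]
  rw [h₁, h₂, two_mul]

/-- Expand the square into pairs of paths x, y, sum over the outcomes first, and collect for each x
the partners y that survive. -/
theorem hc1qProb_eq {N : ℕ} {l : Fin N} (hl : (l : ℕ) + 1 = N) (C : RevCircuit N)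
    (M : Finset (Fin N)) (ζ : M → Bool) :
    hc1qProb C M ζ = (∑ x, (quasiWeight C.perm l M (Function.update x l false) ζ : ℝ) /
      2 ^ (M.erase l).card) / 2 ^ N := by
  set π := C.perm with hπ
  have hsq : (1 / √2 : ℝ) ^ (N - 1) * (1 / √2 : ℝ) ^ (N - 1) = 2 / 2 ^ N := by
    rw [← mul_pow, ← mul_div_mul_comm, one_mul, Real.mul_self_sqrt (by norm_num), ← hl,
      Nat.add_sub_cancel, pow_succ, one_div, inv_pow]
    field_simp
  have h₁ : hc1qProb C M ζ = ∑ w : Fin N → Bool, ∑ x, ∑ y, (if ∀ i : M, w i = ζ i then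
      (∏ i, layerEntry l i (w i) (π x i)) * ∏ i, layerEntry l i (w i) (π y i) else 0) *
      ((∏ i, layerEntry l i (x i) false) * ∏ i, layerEntry l i (y i) false) := by
    refine Finset.sum_congr rfl fun w _ => ?_
    rw [hc1qState_eq hl, Complex.norm_real, Real.norm_eq_abs, sq_abs, sq, Finset.sum_mul_sum]
    split_ifs with h
    · refine Finset.sum_congr rfl fun x _ => Finset.sum_congr rfl fun y _ => ?_
      ring
    · simp
  have h₂ : ∀ x, (∑ y, (∑ w : Fin N → Bool, if ∀ i : M, w i = ζ i then
      (∏ i, layerEntry l i (w i) (π x i)) * ∏ i, layerEntry l i (w i) (π y i) else 0) *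
      ((∏ i, layerEntry l i (x i) false) * ∏ i, layerEntry l i (y i) false)) =
      2 * (if x l = false then (quasiWeight π l M x ζ : ℝ) / 2 ^ (M.erase l).card else 0)
        / 2 ^ N := by
    intro x
    -- The second path is reparametrized by the difference e of the two outputs: y = π⁻¹(π x ⊕ e).
    let g : (Fin N → Bool) ≃ (Fin N → Bool) :=
      (Function.Involutive.toPerm (fun e i => π x i ^^ e i) fun e => by funext i; simp).trans π.symm
    have hg : ∀ e i, π (g e) i = (π x i ^^ e i) := fun e i => by
      simp [g, Function.Involutive.toPerm]
    rw [← g.sum_comp]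
    simp only [hg, sum_layer_mul_layer, prod_layerEntry_false hl]
    -- Only differences supported on M contribute; any other one flips an unmeasured wire.
    rw [← Finset.sum_subset (s₁ := Finset.univ.map ⟨_, extendFalse_injective (M := M)⟩)
      (Finset.subset_univ _)]
    · rw [Finset.sum_map]
      simp only [Function.Embedding.coeFn_mk, sum_layer_extendFalse]
      have hg' : ∀ α : M → Bool, g (extendFalse α) l =
        (π.symm fun i => π x i ^^ extendFalse α i) l := fun α => rfl
      by_cases hx : x l = false
      · simp only [hx, if_true, quasiWeight, Int.cast_sum, Finset.sum_div, Finset.mul_sum]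
        refine Finset.sum_congr rfl fun α _ => ?_
        simp only [hg']
        rw [show ∀ a b c : ℝ, a * (1 * b * (c * b)) = a * c * (b * b) by intros; ring, hsq]
        by_cases h₁ : (π.symm fun i => π x i ^^ extendFalse α i) l = false
        · simp only [Contributes, h₁, true_and, if_true]
          split_ifs
          · rw [one_div, inv_pow]
            field_simp
          · simp
        · simp [Contributes, h₁]
      · simp [hx]
    · intro e _ he
      rw [sum_layer_of_notMem, zero_mul]
      by_contra! hne
      refine he (Finset.mem_map.mpr ⟨fun i => e i, Finset.mem_univ _, ?_⟩)
      funext i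
      by_cases hi : i ∈ M
      · simp [extendFalse, hi]
      · simp [extendFalse, hi, Bool.eq_false_of_not_eq_true (hne i hi)]
  rw [h₁, Finset.sum_comm]
  have h₃ := sum_update_false l (fun x => (quasiWeight π l M x ζ : ℝ) / 2 ^ (M.erase l).card)
  beta_reduce at h₃
  rw [h₃, Finset.mul_sum, Finset.sum_div]
  refine Finset.sum_congr rfl fun x _ => ?_
  rw [← h₂ x, Finset.sum_comm]
  simp only [Finset.sum_mul]

theorem hc1qProb_nonneg {N : ℕ} (C : RevCircuit N) (M : Finset (Fin N)) (ζ : M → Bool) :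
    0 ≤ hc1qProb C M ζ := by
  unfold hc1qProb
  positivity

theorem prod_ite_wire {N : ℕ} (l : Fin N) (M : Finset (Fin N)) :
    ∏ i : M, (if (i : Fin N) = l then (1 : ℤ) else 2) = 2 ^ (M.erase l).card := by
  rw [Finset.prod_coe_sort M (fun i => if i = l then (1 : ℤ) else 2), Finset.prod_ite,
    Finset.prod_const_one, one_mul, Finset.prod_const, Finset.filter_ne']

theorem charSign_eq_prod {N : ℕ} {M : Finset (Fin N)} (α ζ : M → Bool) :
    charSign α ζ = ∏ i, if α i && ζ i then -1 else 1 := by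
  have h : ∏ i : M, (if α i && ζ i then (-1 : ℤ) else 1) =
      ∏ i : M, if extendFalse α (i : Fin N) && extendFalse ζ (i : Fin N) then (-1 : ℤ) else 1 := by
    refine Finset.prod_congr rfl fun i _ => ?_
    simp [extendFalse]
  rw [h, Finset.prod_coe_sort M
    (fun i => if extendFalse α i && extendFalse ζ i then (-1 : ℤ) else 1), charSign]
  refine (Finset.prod_subset (Finset.subset_univ _) fun i _ hi => ?_).symm
  simp [extendFalse, hi]

/-- Orthogonality of characters: summing over ζ kills every α except zero. Zero contributes because
its partner is x itself, whose bit l is false, and ζ is then free on the measured wires other than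
l. -/
theorem sum_quasiWeight {N : ℕ} (π : Equiv.Perm (Fin N → Bool)) (l : Fin N) (M : Finset (Fin N))
    (x : Fin N → Bool) (hx : x l = false) :
    ∑ ζ, quasiWeight π l M x ζ = 2 ^ (M.erase l).card := by
  -- The sum over ζ factors over the measured wires, with factor 1 at l, 0 where α is true, and 2
  -- elsewhere.
  have inner : ∀ α : M → Bool, extendFalse α l = false →
      (∑ ζ : M → Bool, if l ∈ M → π x l = extendFalse ζ l then charSign α ζ else 0) =
        ∏ i : M, if (i : Fin N) = l then (1 : ℤ) else if α i then 0 else 2 := by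
    intro α hα
    have h₁ : ∀ i : M, (if (i : Fin N) = l then (1 : ℤ) else if α i then 0 else 2) =
        ∑ b : Bool, if (i : Fin N) = l → π x l = b then (if α i && b then -1 else 1) else 0 := by
      rintro ⟨i, hi⟩
      by_cases h : i = l
      · subst h
        have : α ⟨i, hi⟩ = false := by simpa [extendFalse, hi] using hα
        simp [this]
      · simp only [h, if_false, false_imp_iff, if_true, Fintype.sum_bool]
        cases α ⟨i, hi⟩ <;> simp
    simp only [h₁]
    rw [Finset.prod_univ_sum, Fintype.piFinset_univ]
    refine Finset.sum_congr rfl fun ζ _ => ?_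
    rw [Finset.prod_ite_zero, ← charSign_eq_prod]
    congr 1
    refine propext ⟨fun h i _ e => ?_, fun h hl => ?_⟩
    · have hl : l ∈ M := e ▸ i.2
      rw [h hl]
      simp [extendFalse, ← e]
    · rw [h ⟨l, hl⟩ (Finset.mem_univ _) rfl]
      simp [extendFalse, hl]
  have h₁ : ∀ α : M → Bool, (∑ ζ, if Contributes π l M x α ζ then charSign α ζ else 0) =
      if α = fun _ => false then 2 ^ (M.erase l).card else 0 := by
    intro α
    by_cases hα : (π.symm fun i => π x i ^^ extendFalse α i) l = false ∧ extendFalse α l = false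
    · simp only [Contributes, hα.1, hα.2, true_and]
      rw [inner α hα.2]
      split_ifs with h
      · subst h
        simpa using prod_ite_wire l M
      · obtain ⟨i, hi⟩ : ∃ i, α i = true := by
          by_contra! hne
          exact h (funext fun i => Bool.eq_false_of_not_eq_true (hne i))
        refine Finset.prod_eq_zero (Finset.mem_univ i) ?_
        have : (i : Fin N) ≠ l := by
          rintro e
          have := hα.2
          rw [← e] at this
          simp [extendFalse, hi] at this
        simp [this, hi]
    · rw [if_neg]
      · refine Finset.sum_eq_zero fun ζ _ => if_neg fun h => hα ⟨h.1, h.2.1⟩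
      · rintro rfl
        refine hα ⟨?_, ?_⟩
        · have : (fun i => π x i ^^ extendFalse (fun _ : M => false) i) = π x := by
            funext i; simp [extendFalse]
          rw [this, Equiv.symm_apply_apply, hx]
        · simp [extendFalse]
  unfold quasiWeight
  rw [Finset.sum_comm]
  simp [h₁]

/-- Each term is 0 or ±1, and only assignments α that vanish at l can contribute. -/
theorem abs_quasiWeight_le {N : ℕ} (π : Equiv.Perm (Fin N → Bool)) (l : Fin N)
    (M : Finset (Fin N)) (x : Fin N → Bool) (ζ : M → Bool) :
    |quasiWeight π l M x ζ| ≤ 2 ^ (M.erase l).card := by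
  have h₁ : ∀ i : M, (if (i : Fin N) = l then (1 : ℤ) else 2) =
      ∑ b : Bool, if (i : Fin N) = l → b = false then 1 else 0 := by
    intro i
    by_cases h : (i : Fin N) = l <;> simp [h]
  rw [← prod_ite_wire l M, Finset.prod_congr rfl fun i _ => h₁ i, Finset.prod_univ_sum,
    Fintype.piFinset_univ]
  refine (Finset.abs_sum_le_sum_abs _ _).trans (Finset.sum_le_sum fun α _ => ?_)
  rw [Finset.prod_ite_zero, Finset.prod_const_one]
  by_cases hc : Contributes π l M x α ζ
  · rw [if_pos hc, if_pos]
    · rw [charSign_eq_prod, Finset.abs_prod]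
      refine (Finset.prod_eq_one fun i _ => ?_).le
      split_ifs <;> simp
    · rintro i _ rfl
      simpa [extendFalse] using hc.2.1
  · rw [if_neg hc, abs_zero]
    split_ifs <;> simp

/-! ### Correctness of the simulation -/

theorem List.getD_flatMap_of_length_eq {α β : Type*} {n : ℕ} (l : List α) (f : α → List β)
    (hf : ∀ x ∈ l, (f x).length = n) (d : β) {i k : ℕ} (hk : k < n) :
    (l.flatMap f).getD (i * n + k) d = (l[i]?.map fun x => (f x).getD k d).getD d := by
  induction l generalizing i with
  | nil => simp
  | cons x l ih =>
    have hx : (f x).length = n := hf x (by simp)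
    cases i with
    | zero => simp [List.getElem?_append_left, hx, hk]
    | succ i =>
      rw [List.flatMap_cons, List.getD_append_right _ _ _ _ (by rw [hx]; nlinarith), hx,
        show (i + 1) * n + k - n = i * n + k by rw [add_mul, one_mul]; omega,
        ih fun y hy => hf y (by simp [hy])]
      simp

theorem Gate.length_encode {N : ℕ} (g : Gate N) : g.encode.length = N * 2 := by
  simp [Gate.encode, List.length_flatMap]

/-- The offset N + 1 skips the unary prefix and the separator, after which each gate occupies 2N
bits. Reading past the end gives false, so a missing gate appears to have no target. -/
theorem gateBit_encode {N : ℕ} (C : RevCircuit N) (g : ℕ) (j : Fin N) {k : ℕ} (hk : k < 2) :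
    gateBit C.encode N g j k = (C[g]?.map fun γ =>
      if k = 0 then decide (j ∈ γ.controls) else decide (j = γ.target)).getD false := by
  have hj : (j : ℕ) * 2 + k < N * 2 := by have := j.2; omega
  rw [gateBit, RevCircuit.encode, List.getD_append_right _ _ _ _ (by simp; omega),
    List.length_replicate, show N + 1 + (g * N + j) * 2 + k - N = g * (N * 2) + (j * 2 + k) + 1 by
      have : (g * N + j) * 2 = g * (N * 2) + j * 2 := by ring
      omega, List.getD_cons_succ,
    List.getD_flatMap_of_length_eq (n := N * 2) _ _ (fun x _ => x.length_encode) _ hj]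
  congr 2
  funext γ
  rw [Gate.encode, List.getD_flatMap_of_length_eq (n := 2) _ _ (fun _ _ => rfl) _ hk]
  have : k = 0 ∨ k = 1 := by omega
  rcases this with rfl | rfl <;> simp

theorem List.map_range_eq_ofFn {α : Type*} (n : ℕ) (f : ℕ → α) :
    (List.range n).map f = List.ofFn fun i : Fin n => f i := by
  refine List.ext_getElem (by simp) fun i h₁ h₂ => by simp

theorem List.getD_ofFn {α : Type*} {n : ℕ} (f : Fin n → α) (d : α) (i : Fin n) :
    (List.ofFn f).getD i d = f i := by
  simp [List.getD_eq_getElem?_getD]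

theorem RevCircuit.perm_append {N : ℕ} (C D : RevCircuit N) :
    RevCircuit.perm (C ++ D) = (RevCircuit.perm C).trans (RevCircuit.perm D) := by
  induction C with
  | nil => rfl
  | cons g C ih => simp only [List.cons_append, RevCircuit.perm, ih, Equiv.trans_assoc]

theorem RevCircuit.perm_singleton {N : ℕ} (g : Gate N) (w : Fin N → Bool) :
    RevCircuit.perm [g] w = g.apply w := rfl

/-- The optional gate makes the step the identity beyond the end of the circuit, so the number of
gates need not be known exactly. -/
theorem simStep_encode {N : ℕ} (C : RevCircuit N) (w : Fin N → Bool) (g : ℕ) :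
    simStep C.encode N (List.ofFn w) g = List.ofFn (RevCircuit.perm C[g]?.toList w) := by
  rw [simStep, List.map_range_eq_ofFn]
  congr 1
  funext i
  have hall : decide (∀ j < N, (!gateBit C.encode N g j 0 || (List.ofFn w).getD j false) = true) =
      (C[g]?.map fun γ => decide (∀ j ∈ γ.controls, w j = true)).getD true := by
    rw [Bool.eq_iff_iff, decide_eq_true_eq, ← Fin.forall_iff (p := fun j : Fin N =>
      (!gateBit C.encode N g j 0 || (List.ofFn w).getD j false) = true)]
    simp only [gateBit_encode C g _ two_pos, List.getD_ofFn]
    cases C[g]? with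
    | none => simp
    | some γ =>
      simp only [if_true, Option.map_some, Option.getD_some, decide_eq_true_eq, Bool.or_eq_true,
        Bool.not_eq_true', decide_eq_false_iff_not, or_iff_not_imp_left, not_not]
  rw [List.getD_ofFn, gateBit_encode C g i one_lt_two, hall]
  cases C[g]? with
  | none => simp [RevCircuit.perm]
  | some γ =>
    simp only [Option.map_some, Option.getD_some, Option.toList_some, RevCircuit.perm_singleton,
      Gate.apply, one_ne_zero, if_false]
    by_cases h : ∀ j ∈ γ.controls, w j = true
    · rw [if_pos h]
      by_cases hi : i = γ.target
      · subst hi; rw [decide_eq_true h]; simp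
      · simp [hi]
    · simp [h]

theorem simForward_encode {N : ℕ} (C : RevCircuit N) (w : Fin N → Bool) (g : ℕ) :
    simForward C.encode N (List.ofFn w) g = List.ofFn (RevCircuit.perm (C.take g) w) := by
  induction g with
  | zero => simp [simForward, RevCircuit.perm]
  | succ g ih => rw [simForward, ih, simStep_encode, List.take_add_one, RevCircuit.perm_append]; rfl

theorem RevCircuit.perm_optionToList_symm {N : ℕ} (o : Option (Gate N)) :
    (RevCircuit.perm o.toList).symm = RevCircuit.perm o.toList := by
  cases o with
  | none => rfl
  | some γ => ext w; simp [RevCircuit.perm, Gate.perm]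

/-- Gates are involutions, so applying them in reverse order inverts the circuit. Any upper bound G
on the number of gates will do. -/
theorem simBackward_encode {N : ℕ} (C : RevCircuit N) (w : Fin N → Bool) {g G : ℕ} (hg : g ≤ G)
    (hG : C.length ≤ G) :
    simBackward C.encode N G (List.ofFn w) g =
      List.ofFn ((RevCircuit.perm (C.drop (G - g))).symm w) := by
  induction g with
  | zero => simp [simBackward, List.drop_eq_nil_of_le hG, RevCircuit.perm]
  | succ g ih =>
    have : C.drop (G - (g + 1)) = C[G - 1 - g]?.toList ++ C.drop (G - g) := by
      rw [show G - (g + 1) = G - 1 - g by omega, show G - g = G - 1 - g + 1 by omega]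
      generalize G - 1 - g = k
      by_cases hk : k < C.length
      · rw [List.drop_eq_getElem_cons hk, List.getElem?_eq_getElem hk]; rfl
      · rw [List.drop_eq_nil_of_le (by omega), List.drop_eq_nil_of_le (by omega),
          List.getElem?_eq_none (by omega)]
        rfl
    rw [simBackward, ih (by omega), simStep_encode, this, RevCircuit.perm_append,
      Equiv.symm_trans_apply, RevCircuit.perm_optionToList_symm]

/-- Justifies using the length of the description as the number of simulation steps. -/
theorem RevCircuit.length_le_length_encode {N : ℕ} (hN : 1 ≤ N) (C : RevCircuit N) :
    C.length ≤ C.encode.length := by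
  have : C.length ≤ (C.flatMap Gate.encode).length := by
    simp only [List.length_flatMap, Gate.length_encode, List.map_const', List.sum_replicate,
      smul_eq_mul]
    exact Nat.le_mul_of_pos_right _ (by omega)
  rw [RevCircuit.encode, List.length_append, List.length_cons]
  omega

theorem encodeSet_eq_ofFn {N : ℕ} (M : Finset (Fin N)) :
    encodeSet M = List.ofFn fun i => decide (i ∈ M) := by
  rw [encodeSet, List.ofFn_eq_map]

theorem getD_encodeSet {N : ℕ} (M : Finset (Fin N)) (i : Fin N) :
    (encodeSet M).getD i false = decide (i ∈ M) := by
  rw [encodeSet_eq_ofFn, List.getD_ofFn]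

/-- The assignment with the number `z`. -/
def assignment {N : ℕ} (M : Finset (Fin N)) (z : ℕ) (i : M) : Bool :=
  wireBit (encodeSet M) z (i : Fin N)

theorem extendFalse_assignment {N : ℕ} (M : Finset (Fin N)) (z : ℕ) (i : Fin N) :
    extendFalse (assignment M z) i = (decide (i ∈ M) && wireBit (encodeSet M) z i) := by
  by_cases h : i ∈ M <;> simp [extendFalse, assignment, h]

theorem flipWires_encodeSet {N : ℕ} (M : Finset (Fin N)) (a : ℕ) (y : Fin N → Bool) :
    flipWires (encodeSet M) N a (List.ofFn y) =
      List.ofFn fun i => y i ^^ extendFalse (assignment M a) i := by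
  rw [flipWires, List.map_range_eq_ofFn]
  simp only [List.getD_ofFn, getD_encodeSet, extendFalse_assignment]

theorem contributes_encode {N : ℕ} {l : Fin N} (hl : (l : ℕ) + 1 = N) (C : RevCircuit N)
    (M : Finset (Fin N)) (x : Fin N → Bool) (a z : ℕ) :
    contributes C.encode N (encodeSet M) (List.ofFn x) a z =
      decide (Contributes C.perm l M x (assignment M a) (assignment M z)) := by
  have hN : 1 ≤ N := by omega
  have hlen := C.length_le_length_encode hN
  have hl' : N - 1 = (l : ℕ) := by omega
  have hy : simForward C.encode N (List.ofFn x) C.encode.length = List.ofFn (C.perm x) := by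
    rw [simForward_encode, List.take_of_length_le hlen]
  rw [contributes, hy, flipWires_encodeSet, simBackward_encode C _ le_rfl hlen, Nat.sub_self,
    List.drop_zero, hl', List.getD_ofFn, List.getD_ofFn, getD_encodeSet,
    ← extendFalse_assignment, Bool.eq_iff_iff, decide_eq_true_eq]
  simp only [Contributes, Bool.and_eq_true, Bool.not_eq_true', Bool.or_eq_true,
    beq_iff_eq, decide_eq_false_iff_not, and_assoc]
  refine and_congr_right fun _ => and_congr_right fun _ => ?_
  by_cases h : l ∈ M <;> simp [h, extendFalse_assignment]

theorem charSign_assignment {N : ℕ} (M : Finset (Fin N)) (a z : ℕ) :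
    charSign (assignment M a) (assignment M z) =
      if signBit (encodeSet M) N a z then -1 else 1 := by
  have h : ∀ i : Fin N, (if extendFalse (assignment M a) i && extendFalse (assignment M z) i then
      (-1 : ℤ) else 1) = (-1) ^ ((encodeSet M).getD i false &&
        (wireBit (encodeSet M) a i && wireBit (encodeSet M) z i)).toNat := by
    intro i
    rw [getD_encodeSet, extendFalse_assignment, extendFalse_assignment]
    cases decide (i ∈ M) <;> cases wireBit (encodeSet M) a i <;>
      cases wireBit (encodeSet M) z i <;> rfl
  rw [charSign, Finset.prod_congr rfl fun i _ => h i, Finset.prod_pow_eq_pow_sum,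
    Fin.sum_univ_eq_sum_range (fun i => ((encodeSet M).getD i false &&
        (wireBit (encodeSet M) a i && wireBit (encodeSet M) z i)).toNat), signBit]
  generalize (∑ i ∈ Finset.range N, ((encodeSet M).getD i false &&
    (wireBit (encodeSet M) a i && wireBit (encodeSet M) z i)).toNat) = n
  rcases Nat.even_or_odd n with h | h
  · simp [h.neg_one_pow, Nat.even_iff.mp h]
  · simp [h.neg_one_pow, Nat.odd_iff.mp h]

theorem rank_succ (M : List Bool) (i : ℕ) :
    rank M (i + 1) = rank M i + (M.getD i false).toNat := Finset.sum_range_succ _ _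

theorem rank_encodeSet {N : ℕ} (M : Finset (Fin N)) : rank (encodeSet M) N = M.card := by
  rw [rank, ← Fin.sum_univ_eq_sum_range (fun j => ((encodeSet M).getD j false).toNat)]
  simp only [getD_encodeSet]
  rw [Finset.card_eq_sum_ones, ← Finset.sum_subset (Finset.subset_univ M)]
  · exact Finset.sum_congr rfl fun i hi => by simp [hi]
  · intro i _ hi; simp [hi]

/-- The positions of the selected wires, in order, count `0, 1, …`. -/
theorem filterMap_rank {N : ℕ} {β : Type*} (M : Finset (Fin N)) (f : ℕ → β) :
    ((List.finRange N).filterMap fun i =>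
      if i ∈ M then some (f (rank (encodeSet M) i)) else none) = (List.range M.card).map f := by
  have h : ∀ n ≤ N, (((List.finRange N).take n).filterMap fun i =>
      if i ∈ M then some (f (rank (encodeSet M) i)) else none) =
        (List.range (rank (encodeSet M) n)).map f := by
    intro n hn
    induction n with
    | zero => simp [rank]
    | succ n ih =>
      rw [List.take_add_one, List.filterMap_append, ih (by omega), rank_succ]
      have : (List.finRange N)[n]? = some ⟨n, hn⟩ := by simp [Nat.lt_of_succ_le hn]
      rw [this]
      have e := getD_encodeSet M ⟨n, hn⟩
      simp only at e
      rw [e]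
      by_cases hm : (⟨n, hn⟩ : Fin N) ∈ M
      · simp [hm, List.range_succ]
      · simp [hm]
  have := h N le_rfl
  rwa [List.take_of_length_le (by simp), rank_encodeSet] at this

theorem encodeResult_assignment {N : ℕ} (M : Finset (Fin N)) (z : ℕ) :
    encodeResult (assignment M z) = (List.range M.card).map fun j => z.testBit j := by
  rw [← filterMap_rank M fun j => z.testBit j, encodeResult]
  congr 1

theorem rank_surjOn {N : ℕ} (M : Finset (Fin N)) {j : ℕ} (hj : j < M.card) :
    ∃ i ∈ M, rank (encodeSet M) i = j := by
  have h : j ∈ (List.range M.card).map id := by simpa using hj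
  rw [← filterMap_rank M id, List.mem_filterMap] at h
  obtain ⟨i, _, hi⟩ := h
  by_cases hm : i ∈ M
  · exact ⟨i, hm, by simpa [hm] using hi⟩
  · simp [hm] at hi

/-- Assignments are numbered by the numbers below `2 ^ |M|`. -/
theorem assignment_injOn {N : ℕ} (M : Finset (Fin N)) :
    Set.InjOn (assignment M) (Finset.range (2 ^ M.card)) := by
  intro a ha b hb h
  simp only [Finset.coe_range, Set.mem_Iio] at ha hb
  refine Nat.eq_of_testBit_eq fun j => ?_
  by_cases hj : j < M.card
  · obtain ⟨i, hi, rfl⟩ := rank_surjOn M hj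
    exact congrFun h ⟨i, hi⟩
  · rw [Nat.testBit_eq_false_of_lt (ha.trans_le (Nat.pow_le_pow_right two_pos (by omega))),
      Nat.testBit_eq_false_of_lt (hb.trans_le (Nat.pow_le_pow_right two_pos (by omega)))]

theorem sum_assignment {N : ℕ} {R : Type*} [AddCommMonoid R] (M : Finset (Fin N))
    (f : (M → Bool) → R) :
    ∑ z ∈ Finset.range (2 ^ M.card), f (assignment M z) = ∑ ζ, f ζ := by
  have himg : (Finset.range (2 ^ M.card)).image (assignment M) = Finset.univ := by
    rw [← Finset.card_eq_iff_eq_univ, Finset.card_image_of_injOn (assignment_injOn M)]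
    simp
  rw [← himg, Finset.sum_image (assignment_injOn M)]

/-! ### Sampling from the mean of quasi-probabilities -/

/-- Replacing a quasi-probability by its normalized positive part at most triples the distance to a
nonnegative function. -/
theorem sum_abs_sub_normalized_posPart_le {Z : Type*} (s : Finset Z) (p g : Z → ℝ)
    (hp : ∀ z ∈ s, 0 ≤ p z) (hg : ∑ z ∈ s, g z = 1) :
    ∑ z ∈ s, |p z - max (g z) 0 / ∑ y ∈ s, max (g y) 0| ≤ 3 * ∑ z ∈ s, |p z - g z| := by
  set c := ∑ y ∈ s, max (g y) 0 with hc
  have hc1 : 1 ≤ c := hg ▸ Finset.sum_le_sum fun z _ => le_max_left _ _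
  -- Three errors: the distance to g, the removal of the negative part, and the normalization. As g
  -- sums to 1, the last two both sum to c - 1, which is bounded by the first.
  have h₁ : ∀ z ∈ s, |p z - max (g z) 0 / c| ≤
      |p z - g z| + (max (g z) 0 - g z) + (max (g z) 0 - max (g z) 0 / c) := by
    intro z _
    have e₁ : 0 ≤ max (g z) 0 - g z := sub_nonneg.mpr (le_max_left _ _)
    have e₂ : 0 ≤ max (g z) 0 - max (g z) 0 / c :=
      sub_nonneg.mpr (div_le_self (le_max_right _ _) hc1)
    have e₃ := le_abs_self (p z - g z)
    have e₄ := neg_abs_le (p z - g z)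
    rw [abs_le]
    constructor <;> linarith
  have h₂ : ∀ z ∈ s, max (g z) 0 - g z ≤ |p z - g z| := by
    intro z hz
    have := hp z hz
    rcases max_cases (g z) 0 with ⟨h, _⟩ | ⟨h, _⟩ <;> rw [h]
    · simp
    · exact (by linarith : 0 - g z ≤ p z - g z).trans (le_abs_self _)
  have h₃ := Finset.sum_le_sum h₁
  have h₄ := Finset.sum_le_sum h₂
  simp only [Finset.sum_add_distrib, Finset.sum_sub_distrib, ← Finset.sum_div, ← hc, hg] at h₃ h₄
  rw [div_self (by linarith)] at h₃
  linarith

theorem sum_pi_succ {X : Type*} [Fintype X] {R : Type*} [AddCommMonoid R] (T : ℕ)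
    (f : (Fin (T + 1) → X) → R) : ∑ xs, f xs = ∑ x : X, ∑ xs : Fin T → X, f (Fin.cons x xs) := by
  rw [← (Fin.consEquiv fun _ : Fin (T + 1) => X).sum_comp, Fintype.sum_prod_type]
  rfl

/-- The second moment of a sum of independent centered samples. -/
theorem sum_sq_sum_samples {X : Type*} [Fintype X] (h : X → ℝ) (h₀ : ∑ x, h x = 0) (T : ℕ) :
    (∑ xs : Fin T → X, ∑ t, h (xs t) = 0) ∧
      (∑ xs : Fin T → X, (∑ t, h (xs t)) ^ 2) * Fintype.card X =
        T * Fintype.card X ^ T * ∑ x, h x ^ 2 := by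
  induction T with
  | zero => simp
  | succ T ih =>
    obtain ⟨ih₁, ih₂⟩ := ih
    refine ⟨?_, ?_⟩
    · rw [sum_pi_succ]
      simp [Fin.sum_univ_succ, Finset.sum_add_distrib, ih₁, ← Finset.mul_sum, h₀]
    · rw [sum_pi_succ]
      simp only [Fin.sum_univ_succ, Fin.cons_zero, Fin.cons_succ, add_sq, Finset.sum_add_distrib,
        ← Finset.mul_sum, ih₁, Finset.sum_const, Finset.card_univ, Fintype.card_fun,
        Fintype.card_fin, nsmul_eq_mul, mul_zero, add_zero]
      push_cast
      rw [pow_succ, add_mul, mul_assoc (Fintype.card X : ℝ) (∑ xs : Fin T → X, _), ih₂]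
      ring

/-- The centered values are at most 2, so the sum of k² independent ones has mean square at most
4k². A square number of samples avoids square roots in the bound. -/
theorem sum_abs_mean_sub_le {X : Type*} [Fintype X] [Nonempty X] (f : X → ℝ) (hf : ∀ x, |f x| ≤ 1)
    {k : ℕ} (hk : 0 < k) :
    ∑ xs : Fin (k ^ 2) → X, |(∑ x, f x) / Fintype.card X - (∑ t, f (xs t)) / (k ^ 2 : ℕ)| ≤
      2 / k * Fintype.card X ^ k ^ 2 := by
  set n : ℝ := ((Fintype.card X : ℕ) : ℝ) with hn
  have hn0 : 0 < n := by rw [hn]; exact_mod_cast Fintype.card_pos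
  have hk0 : (0 : ℝ) < k := by exact_mod_cast hk
  set p := (∑ x, f x) / n with hp
  have hp1 : |p| ≤ 1 := by
    rw [hp, abs_div, abs_of_pos hn0, div_le_one hn0]
    refine (Finset.abs_sum_le_sum_abs _ _).trans ((Finset.sum_le_sum fun x _ => hf x).trans ?_)
    simp [hn]
  let h : X → ℝ := fun x => f x - p
  have h₀ : ∑ x, h x = 0 := by
    simp only [h, Finset.sum_sub_distrib, Finset.sum_const, Finset.card_univ, nsmul_eq_mul, ← hn]
    rw [hp]; field_simp; ring
  have h₄ : ∑ x, h x ^ 2 ≤ n * 4 := by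
    have : ∀ x ∈ Finset.univ, h x ^ 2 ≤ 4 := by
      intro x _
      have e : |h x| ≤ 2 := (abs_sub _ _).trans (by linarith [hf x])
      rw [← sq_abs]
      nlinarith [abs_nonneg (h x)]
    refine (Finset.sum_le_sum this).trans ?_
    simp [hn]
  have hmom := (sum_sq_sum_samples h h₀ (k ^ 2)).2
  rw [← hn] at hmom
  have hmom' : ∑ xs : Fin (k ^ 2) → X, (∑ t, h (xs t)) ^ 2 ≤ 4 * k ^ 2 * n ^ k ^ 2 := by
    have e : (∑ xs : Fin (k ^ 2) → X, (∑ t, h (xs t)) ^ 2) * n ≤ 4 * k ^ 2 * n ^ k ^ 2 * n := by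
      rw [hmom]
      calc _ ≤ ((k ^ 2 : ℕ) : ℝ) * n ^ k ^ 2 * (n * 4) := by gcongr
        _ = _ := by push_cast; ring
    exact le_of_mul_le_mul_right e hn0
  have hpt : ∀ xs : Fin (k ^ 2) → X, |p - (∑ t, f (xs t)) / (k ^ 2 : ℕ)| ≤
      (∑ t, h (xs t)) ^ 2 / (4 * k ^ 3) + 1 / k := by
    intro xs
    have e : p - (∑ t, f (xs t)) / (k ^ 2 : ℕ) = -(∑ t, h (xs t)) / k ^ 2 := by
      simp only [h, Finset.sum_sub_distrib, Finset.sum_const, Finset.card_univ, Fintype.card_fin,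
        nsmul_eq_mul]
      push_cast
      field_simp
      ring
    rw [e]
    generalize ∑ t, h (xs t) = u
    rw [abs_div, abs_neg, abs_of_pos (by positivity : (0 : ℝ) < k ^ 2), ← sq_abs u]
    -- Completing the square replaces Cauchy-Schwarz: both terms of the pointwise bound then
    -- contribute at most 1/k on average.
    have e₂ : |u| ^ 2 / (4 * k ^ 3) + 1 / k - |u| / k ^ 2 = (|u| - 2 * k) ^ 2 / (4 * k ^ 3) := by
      field_simp
      ring
    have : 0 ≤ (|u| - 2 * k) ^ 2 / (4 * k ^ 3) := by positivity
    linarith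
  refine (Finset.sum_le_sum fun xs _ => hpt xs).trans ?_
  rw [Finset.sum_add_distrib, ← Finset.sum_div, Finset.sum_const, Finset.card_univ,
    Fintype.card_fun, Fintype.card_fin, nsmul_eq_mul]
  push_cast
  rw [← hn]
  calc _ ≤ 4 * k ^ 2 * n ^ k ^ 2 / (4 * k ^ 3) + n ^ k ^ 2 * (1 / k) := by gcongr
    _ = _ := by field_simp; ring

/-! ### Selection with given weights -/

/-- The index `z < K` with `∑_{y<z} W y ≤ v < ∑_{y≤z} W y`. -/
def selectIndex (W : ℕ → ℕ) (K v : ℕ) : ℕ :=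
  ∑ z ∈ Finset.range K, (decide (∑ y ∈ Finset.range (z + 1), W y ≤ v)).toNat

theorem selectIndex_eq {W : ℕ → ℕ} {K v z : ℕ} (hz : z < K) (h₁ : ∑ y ∈ Finset.range z, W y ≤ v)
    (h₂ : v < ∑ y ∈ Finset.range (z + 1), W y) : selectIndex W K v = z := by
  have hmono : Monotone fun z => ∑ y ∈ Finset.range z, W y :=
    monotone_nat_of_le_succ fun z => by rw [Finset.sum_range_succ]; omega
  have : ∀ x ∈ Finset.range K, (decide (∑ y ∈ Finset.range (x + 1), W y ≤ v)).toNat =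
      if x ∈ Finset.range z then 1 else 0 := by
    intro x _
    by_cases hx : x < z
    · have := (hmono (Nat.succ_le_of_lt hx)).trans h₁
      simp only [Nat.succ_eq_add_one] at this
      simp [hx, this]
    · have := h₂.trans_le (hmono (show z + 1 ≤ x + 1 by omega))
      simp [hx, this]
  rw [selectIndex, Finset.sum_congr rfl this, Finset.sum_ite_mem,
    Finset.inter_eq_right.mpr (Finset.range_mono hz.le)]
  simp

theorem exists_index {W : ℕ → ℕ} {K v : ℕ} (hv : v < ∑ y ∈ Finset.range K, W y) :
    ∃ z < K, ∑ y ∈ Finset.range z, W y ≤ v ∧ v < ∑ y ∈ Finset.range (z + 1), W y := by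
  induction K with
  | zero => simp at hv
  | succ K ih =>
    by_cases h : v < ∑ y ∈ Finset.range K, W y
    · obtain ⟨z, hz, h⟩ := ih h
      exact ⟨z, by omega, h⟩
    · exact ⟨K, by omega, by omega, hv⟩

theorem selectIndex_lt {W : ℕ → ℕ} {K v : ℕ} (hv : v < ∑ y ∈ Finset.range K, W y) :
    selectIndex W K v < K := by
  obtain ⟨z, hz, h₁, h₂⟩ := exists_index hv
  rwa [selectIndex_eq hz h₁ h₂]

/-- The values v that select z form the interval between two consecutive partial sums. -/
theorem card_selectIndex_eq {W : ℕ → ℕ} {K z : ℕ} (hz : z < K) :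
    ((Finset.range (∑ y ∈ Finset.range K, W y)).filter fun v => selectIndex W K v = z).card =
      W z := by
  have : ((Finset.range (∑ y ∈ Finset.range K, W y)).filter fun v => selectIndex W K v = z) =
      Finset.Ico (∑ y ∈ Finset.range z, W y) (∑ y ∈ Finset.range (z + 1), W y) := by
    ext v
    simp only [Finset.mem_filter, Finset.mem_range, Finset.mem_Ico]
    constructor
    · rintro ⟨hv, rfl⟩
      obtain ⟨z, hz, h₁, h₂⟩ := exists_index hv
      rw [selectIndex_eq hz h₁ h₂]
      exact ⟨h₁, h₂⟩
    · rintro ⟨h₁, h₂⟩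
      refine ⟨h₂.trans_le ?_, selectIndex_eq hz h₁ h₂⟩
      exact Finset.sum_le_sum_of_subset (Finset.range_mono hz)
  rw [this, Nat.card_Ico, Finset.sum_range_succ]
  omega

/-- Residues of a uniform number below `Q` are almost uniform. -/
theorem abs_card_mod_sub_le {Q S v : ℕ} (hQ : 0 < Q) (hv : v < S) :
    |(((Finset.range Q).filter fun B => B % S = v).card : ℝ) / Q - 1 / S| ≤ 1 / Q := by
  have hS : 0 < S := by omega
  have hcard : ((Finset.range Q).filter fun B => B % S = v).card =
      Q / S + if v < Q % S then 1 else 0 := by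
    have := Nat.count_modEq_card Q hS v
    rw [Nat.count_eq_card_filter_range, Nat.mod_eq_of_lt hv] at this
    rw [← this]
    congr 1
    ext B
    simp [Nat.ModEq, Nat.mod_eq_of_lt hv]
  set c := ((Finset.range Q).filter fun B => B % S = v).card
  have h₁ : c * S ≤ Q + S := by
    have := Nat.div_mul_le_self Q S
    rw [hcard, add_mul]
    split_ifs <;> omega
  have h₂ : Q ≤ c * S + S := by
    have := Nat.div_add_mod' Q S
    have := Nat.mod_lt Q hS
    rw [hcard, add_mul]
    split_ifs <;> omega
  have hQ' : (0 : ℝ) < Q := by exact_mod_cast hQ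
  have hS' : (0 : ℝ) < S := by exact_mod_cast hS
  have h₁' : (c : ℝ) * S ≤ Q + S := by exact_mod_cast h₁
  have h₂' : (Q : ℝ) ≤ c * S + S := by exact_mod_cast h₂
  rw [div_sub_div _ _ hQ'.ne' hS'.ne', abs_div, abs_of_pos (mul_pos hQ' hS'),
    div_le_div_iff₀ (mul_pos hQ' hS') hQ']
  have : |(c : ℝ) * S - Q * 1| ≤ S := by rw [abs_le]; constructor <;> linarith
  nlinarith

/-- Outcome z collects W z residues, each with probability off by at most 1/Q. -/
theorem sum_abs_selectIndex_sub_le {W : ℕ → ℕ} {K Q : ℕ} (hQ : 0 < Q)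
    (hS : 0 < ∑ y ∈ Finset.range K, W y) :
    ∑ z ∈ Finset.range K, |(((Finset.range Q).filter fun B =>
        selectIndex W K (B % ∑ y ∈ Finset.range K, W y) = z).card : ℝ) / Q -
      W z / (∑ y ∈ Finset.range K, W y : ℕ)| ≤ (∑ y ∈ Finset.range K, W y : ℕ) / Q := by
  set S := ∑ y ∈ Finset.range K, W y with hSdef
  have key : ∀ z ∈ Finset.range K, |(((Finset.range Q).filter fun B =>
      selectIndex W K (B % S) = z).card : ℝ) / Q - W z / S| ≤ W z / Q := by
    intro z hz
    have hz := Finset.mem_range.mp hz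
    have hW := card_selectIndex_eq (W := W) hz
    rw [← hSdef] at hW
    set s := (Finset.range S).filter fun v => selectIndex W K v = z
    have hfib : ((Finset.range Q).filter fun B => selectIndex W K (B % S) = z).card =
        ∑ v ∈ s, ((Finset.range Q).filter fun B => B % S = v).card := by
      rw [Finset.card_eq_sum_card_fiberwise (f := fun B => B % S) (t := s)]
      · refine Finset.sum_congr rfl fun v hv => ?_
        congr 1
        ext B
        simp only [Finset.mem_filter, s] at hv ⊢
        constructor
        · rintro ⟨⟨h₁, _⟩, h₂⟩; exact ⟨h₁, h₂⟩
        · rintro ⟨h₁, rfl⟩; exact ⟨⟨h₁, hv.2⟩, rfl⟩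
      · intro B hB
        simp only [Finset.coe_filter, Finset.mem_range, Set.mem_ofPred_eq, s] at hB ⊢
        exact ⟨Nat.mod_lt _ hS, hB.2⟩
    have hW' : (W z : ℝ) / S = ∑ v ∈ s, 1 / (S : ℝ) := by
      rw [Finset.sum_const, hW, nsmul_eq_mul, mul_one_div]
    rw [hfib, hW', Nat.cast_sum, Finset.sum_div, ← Finset.sum_sub_distrib]
    refine (Finset.abs_sum_le_sum_abs _ _).trans ((Finset.sum_le_sum fun v hv =>
      abs_card_mod_sub_le hQ (Finset.mem_range.mp (Finset.mem_filter.mp hv).1)).trans ?_)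
    rw [Finset.sum_const, hW, nsmul_eq_mul, mul_one_div]
  refine (Finset.sum_le_sum key).trans ?_
  rw [← Finset.sum_div, hSdef]
  push_cast
  rfl

/-- The weights from the samples `xs`: the sum of the quasi-probabilities, cut off at zero. -/
def sampleWeight {X : Type*} (F : X → ℕ → ℤ) {T : ℕ} (xs : Fin T → X) (z : ℕ) : ℕ :=
  (∑ t, F (xs t) z).toNat

section

variable {X : Type*} {F : X → ℕ → ℤ} {K R : ℕ}

/-- Cutting off at zero only increases the total. In particular the total is positive for all
samples when T and R are, so selection never fails. -/
theorem le_sum_sampleWeight (hsum : ∀ x, ∑ z ∈ Finset.range K, F x z = R) {T : ℕ}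
    (xs : Fin T → X) : T * R ≤ ∑ z ∈ Finset.range K, sampleWeight F xs z := by
  have : ((T * R : ℕ) : ℤ) ≤ (∑ z ∈ Finset.range K, sampleWeight F xs z : ℕ) := by
    push_cast
    calc (T * R : ℤ) = ∑ z ∈ Finset.range K, ∑ t, F (xs t) z := by
          rw [Finset.sum_comm]; simp [hsum]
      _ ≤ _ := Finset.sum_le_sum fun z _ => Int.self_le_toNat _
  exact_mod_cast this

theorem sum_sampleWeight_le (hle : ∀ x, ∀ z, |F x z| ≤ R) {T : ℕ} (xs : Fin T → X) :
    ∑ z ∈ Finset.range K, sampleWeight F xs z ≤ K * (T * R) := by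
  have h : ∀ z ∈ Finset.range K, sampleWeight F xs z ≤ T * R := by
    intro z _
    refine Int.toNat_le.mpr ?_
    refine (le_abs_self _).trans ((Finset.abs_sum_le_sum_abs _ _).trans
      ((Finset.sum_le_sum fun t _ => hle (xs t) z).trans ?_))
    simp
  simpa using Finset.sum_le_sum h

/-- For fixed samples the error is at most three times that of the empirical mean plus the rounding
of the selection. Averaging over the samples bounds the former by 3 · K · 2/k. -/
theorem sampling_error [Fintype X] [Nonempty X] (hR : 0 < R)
    (hsum : ∀ x, ∑ z ∈ Finset.range K, F x z = R)
    (hle : ∀ x, ∀ z, |F x z| ≤ R) (p : ℕ → ℝ)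
    (hp : ∀ z, p z = (∑ x, (F x z : ℝ) / R) / Fintype.card X) (hp₀ : ∀ z, 0 ≤ p z)
    {k Q : ℕ} (hk : 0 < k) (hQ : 0 < Q) :
    ∑ z ∈ Finset.range K, |p z - (∑ xs : Fin (k ^ 2) → X,
      (((Finset.range Q).filter fun B => selectIndex (sampleWeight F xs) K
        (B % ∑ y ∈ Finset.range K, sampleWeight F xs y) = z).card : ℝ) / Q) /
          Fintype.card X ^ k ^ 2| ≤ 6 * K / k + K * (k ^ 2 * R) / Q := by
  set n : ℝ := ((Fintype.card X : ℕ) : ℝ) with hn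
  have hn0 : 0 < n := by rw [hn]; exact_mod_cast Fintype.card_pos
  have hk0 : (0 : ℝ) < k := by exact_mod_cast hk
  have hR0 : (0 : ℝ) < R := by exact_mod_cast hR
  have hQ0 : (0 : ℝ) < Q := by exact_mod_cast hQ
  set q : (Fin (k ^ 2) → X) → ℕ → ℝ := fun xs z =>
    (((Finset.range Q).filter fun B => selectIndex (sampleWeight F xs) K
        (B % ∑ y ∈ Finset.range K, sampleWeight F xs y) = z).card : ℝ) / Q with hq
  have hN0 : 0 < n ^ k ^ 2 := pow_pos hn0 _
  have hcard : ∀ a : ℝ, ∑ _xs : Fin (k ^ 2) → X, a = n ^ k ^ 2 * a := by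
    intro a; simp [hn]
  have step₁ : ∀ z ∈ Finset.range K, |p z - (∑ xs, q xs z) / n ^ k ^ 2| ≤
      (∑ xs, |p z - q xs z|) / n ^ k ^ 2 := by
    intro z _
    have : p z - (∑ xs, q xs z) / n ^ k ^ 2 = (∑ xs, (p z - q xs z)) / n ^ k ^ 2 := by
      rw [Finset.sum_sub_distrib, hcard]; field_simp
    rw [this, abs_div, abs_of_pos hN0]
    gcongr
    exact Finset.abs_sum_le_sum_abs _ _
  have step₂ : ∀ xs, ∑ z ∈ Finset.range K, |p z - q xs z| ≤
      3 * ∑ z ∈ Finset.range K, |p z - (∑ t, (F (xs t) z : ℝ) / R) / (k ^ 2 : ℕ)| +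
        K * (k ^ 2 * R) / Q := by
    intro xs
    set W := sampleWeight F xs with hW
    set g : ℕ → ℝ := fun z => (∑ t, (F (xs t) z : ℝ) / R) / (k ^ 2 : ℕ) with hg
    have hTR : (0 : ℝ) < (k ^ 2 : ℕ) * R := by positivity
    have hgF : ∀ z, g z = ((∑ t, F (xs t) z : ℤ) : ℝ) / ((k ^ 2 : ℕ) * R) := by
      intro z
      rw [hg]
      beta_reduce
      rw [← Finset.sum_div, div_div, mul_comm (R : ℝ)]
      push_cast
      rfl
    have hmax : ∀ z, max (g z) 0 = (W z : ℝ) / ((k ^ 2 : ℕ) * R) := by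
      intro z
      have : (W z : ℝ) = max ((∑ t, F (xs t) z : ℤ) : ℝ) 0 := by
        have := Int.toNat_eq_max (∑ t, F (xs t) z)
        rw [hW, sampleWeight]
        exact_mod_cast congrArg (Int.cast : ℤ → ℝ) this
      rw [hgF, this]
      rcases le_total (((∑ t, F (xs t) z : ℤ) : ℝ)) 0 with h | h
      · rw [max_eq_right h, max_eq_right (div_nonpos_of_nonpos_of_nonneg h hTR.le), zero_div]
      · rw [max_eq_left h, max_eq_left (div_nonneg h hTR.le)]
    have hgsum : ∑ z ∈ Finset.range K, g z = 1 := by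
      have : ∑ z ∈ Finset.range K, ∑ t, F (xs t) z = (k ^ 2 : ℕ) * R := by
        rw [Finset.sum_comm]; simp [hsum]
      simp only [hgF]
      rw [← Finset.sum_div, ← Int.cast_sum, this]
      push_cast
      exact div_self (by push_cast at hTR; exact hTR.ne')
    have hS := le_sum_sampleWeight hsum xs
    have hS0 : 0 < ∑ y ∈ Finset.range K, W y := (by positivity : 0 < k ^ 2 * R).trans_le hS
    have a₁ := sum_abs_sub_normalized_posPart_le (Finset.range K) p g (fun z _ => hp₀ z) hgsum
    have a₂ := sum_abs_selectIndex_sub_le (W := W) (K := K) hQ hS0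
    have a₃ : ((∑ y ∈ Finset.range K, W y : ℕ) : ℝ) / Q ≤ K * (k ^ 2 * R) / Q := by
      gcongr
      exact_mod_cast sum_sampleWeight_le hle xs
    -- The common denominator k²R cancels, so the algorithm can work with integer weights.
    have hratio : ∀ z, max (g z) 0 / ∑ y ∈ Finset.range K, max (g y) 0 =
        W z / (∑ y ∈ Finset.range K, W y : ℕ) := by
      intro z
      simp only [hmax, ← Finset.sum_div]
      rw [div_div_div_cancel_right₀ hTR.ne']
      push_cast
      rfl
    simp only [hratio] at a₁
    have a₄ : ∑ z ∈ Finset.range K, |p z - q xs z| ≤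
        ∑ z ∈ Finset.range K, |p z - W z / (∑ y ∈ Finset.range K, W y : ℕ)| +
        ∑ z ∈ Finset.range K, |q xs z - W z / (∑ y ∈ Finset.range K, W y : ℕ)| := by
      rw [← Finset.sum_add_distrib]
      refine Finset.sum_le_sum fun z _ => ?_
      rw [abs_sub_comm (q xs z)]
      exact abs_sub_le _ _ _
    linarith
  have step₃ : ∀ z ∈ Finset.range K, ∑ xs : Fin (k ^ 2) → X,
      |p z - (∑ t, (F (xs t) z : ℝ) / R) / (k ^ 2 : ℕ)| ≤ 2 / k * n ^ k ^ 2 := by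
    intro z _
    rw [hp]
    refine sum_abs_mean_sub_le (fun x => (F x z : ℝ) / R) (fun x => ?_) hk
    rw [abs_div, abs_of_pos hR0, div_le_one hR0]
    exact_mod_cast hle x z
  calc _ ≤ ∑ z ∈ Finset.range K, (∑ xs, |p z - q xs z|) / n ^ k ^ 2 := Finset.sum_le_sum step₁
    _ = (∑ xs, ∑ z ∈ Finset.range K, |p z - q xs z|) / n ^ k ^ 2 := by
      rw [← Finset.sum_div, Finset.sum_comm]
    _ ≤ (∑ xs : Fin (k ^ 2) → X, (3 * ∑ z ∈ Finset.range K,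
        |p z - (∑ t, (F (xs t) z : ℝ) / R) / (k ^ 2 : ℕ)| + K * (k ^ 2 * R) / Q)) / n ^ k ^ 2 := by
      gcongr with xs _
      exact step₂ xs
    _ = (3 * (∑ z ∈ Finset.range K, ∑ xs : Fin (k ^ 2) → X,
        |p z - (∑ t, (F (xs t) z : ℝ) / R) / (k ^ 2 : ℕ)|)) / n ^ k ^ 2 + K * (k ^ 2 * R) / Q := by
      rw [Finset.sum_add_distrib, hcard, ← Finset.mul_sum, Finset.sum_comm, add_div,
        mul_div_cancel_left₀ _ hN0.ne']
    _ ≤ (3 * (∑ z ∈ Finset.range K, 2 / k * n ^ k ^ 2)) / n ^ k ^ 2 + K * (k ^ 2 * R) / Q := by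
      gcongr with z hz
      exact step₃ z hz
    _ = _ := by
      rw [Finset.sum_const, Finset.card_range, nsmul_eq_mul]
      field_simp
      ring

end

/-! ### The distribution of the output of the algorithm -/

/-- Horner's scheme from the top digit: after j steps the state is the number formed by the j
leading binary digits, modulo S. -/
theorem digitsMod_eq (ρ : List Bool) (o J : ℕ) {S B : ℕ} (hS : 0 < S) (hB : B < 2 ^ J)
    (hρ : ∀ j < J, ρ.getD (o + j) false = B.testBit j) {j : ℕ} (hj : j ≤ J) :
    digitsMod ρ o J S j = B / 2 ^ (J - j) % S := by
  induction j with
  | zero => simp [digitsMod, Nat.div_eq_of_lt hB]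
  | succ j ih =>
    have hb : (ρ.getD (o + (J - 1 - j)) false).toNat = B / 2 ^ (J - (j + 1)) % 2 := by
      rw [hρ _ (by omega), Nat.toNat_testBit, show J - (j + 1) = J - 1 - j by omega]
    have hd : B / 2 ^ (J - j) = B / 2 ^ (J - (j + 1)) / 2 := by
      rw [Nat.div_div_eq_div_mul, ← pow_succ, show J - (j + 1) + 1 = J - j by omega]
    rw [digitsMod, ih (by omega), hb, hd]
    generalize B / 2 ^ (J - (j + 1)) = D
    have hlt := Nat.mod_lt (D / 2) hS
    have hmod : (2 * (D / 2 % S) + D % 2) % S = D % S := by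
      conv_rhs => rw [← Nat.div_add_mod D 2, Nat.add_mod, Nat.mul_mod]
      conv_lhs => rw [Nat.add_mod, Nat.mul_mod, Nat.mod_mod]
    have h2 := Nat.mod_lt D two_pos
    rw [← hmod]
    generalize D / 2 % S = v at hlt ⊢
    generalize D % 2 = b at h2 ⊢
    split_ifs with h
    · rw [Nat.mod_eq_of_lt h]
    -- Doubling a residue and adding a bit stays below 2S, so one subtraction suffices.
    · rw [Nat.mod_eq_sub_mod (by omega), Nat.mod_eq_of_lt (by omega)]

/-- The quasi-probabilities, by number of the assignment, with the last input bit cleared. -/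
def numberedWeight {N : ℕ} (π : Equiv.Perm (Fin N → Bool)) (l : Fin N) (M : Finset (Fin N))
    (x : Fin N → Bool) (z : ℕ) : ℤ :=
  quasiWeight π l M (Function.update x l false) (assignment M z)

/-- Truncated subtraction of the negative from the positive count is the positive part of their
difference. The last coin of each block is ignored, matching the cleared input bit. -/
theorem weight_encode {N T : ℕ} {l : Fin N} (hl : (l : ℕ) + 1 = N) (C : RevCircuit N)
    (M : Finset (Fin N)) (ρ : List Bool) (xs : Fin T → Fin N → Bool)
    (hρ : ∀ (t : Fin T) (i : Fin N), ρ.getD ((i : ℕ) + N * (t : ℕ)) false = xs t i) :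
    weight C.encode N (encodeSet M) ρ T (2 ^ M.card) =
      sampleWeight (numberedWeight C.perm l M) xs := by
  funext z
  have hblock : ∀ t : Fin T, inputBlock ρ N t = List.ofFn (Function.update (xs t) l false) := by
    intro t
    rw [inputBlock, List.map_range_eq_ofFn]
    congr 1
    funext i
    rw [hρ]
    by_cases hi : i = l
    · subst hi; simp [hl]
    · have : (i : ℕ) ≠ l := fun h => hi (Fin.ext h)
      have h2 : (i : ℕ) + 1 < N := by omega
      simp [hi, h2]
  have htally : ∀ sign, tally C.encode N (encodeSet M) ρ T (2 ^ M.card) sign z =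
      ∑ t : Fin T, ∑ a ∈ Finset.range (2 ^ M.card),
        (decide (Contributes C.perm l M (Function.update (xs t) l false) (assignment M a)
          (assignment M z)) && (signBit (encodeSet M) N a z == sign)).toNat := by
    intro sign
    rw [tally, ← Fin.sum_univ_eq_sum_range (fun t => ∑ a ∈ Finset.range (2 ^ M.card),
      (contributes C.encode N (encodeSet M) (inputBlock ρ N t) a z &&
        (signBit (encodeSet M) N a z == sign)).toNat)]
    refine Finset.sum_congr rfl fun t _ => Finset.sum_congr rfl fun a _ => ?_
    rw [hblock, contributes_encode hl]
  rw [weight, ← Int.toNat_sub, sampleWeight, htally, htally]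
  congr 1
  push_cast
  rw [← Finset.sum_sub_distrib]
  refine Finset.sum_congr rfl fun t _ => ?_
  rw [← Finset.sum_sub_distrib, numberedWeight, quasiWeight, ← sum_assignment]
  refine Finset.sum_congr rfl fun a _ => ?_
  rw [charSign_assignment]
  by_cases hc : Contributes C.perm l M (Function.update (xs t) l false) (assignment M a)
      (assignment M z) <;> cases signBit (encodeSet M) N a z <;> simp [hc]

/-- A random string, split into blocks of length `N` and a remainder. -/
def coinEquiv (N T J : ℕ) :
    (Fin T → Fin N → Bool) × (Fin J → Bool) ≃ (Fin (T * N + J) → Bool) :=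
  (Equiv.prodCongr ((Equiv.curry (Fin T) (Fin N) Bool).symm.trans
    (Equiv.arrowCongr finProdFinEquiv (Equiv.refl _))) (Equiv.refl _)).trans
      (Fin.appendEquiv (T * N) J)

theorem getD_coinEquiv_block {N T J : ℕ} (xs : Fin T → Fin N → Bool) (β : Fin J → Bool)
    (t : Fin T) (i : Fin N) :
    (List.ofFn (coinEquiv N T J (xs, β))).getD ((i : ℕ) + N * (t : ℕ)) false = xs t i := by
  have h := List.getD_ofFn (coinEquiv N T J (xs, β)) false
    (Fin.castAdd J (finProdFinEquiv (t, i)))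
  simp only [Fin.val_castAdd, finProdFinEquiv_apply_val] at h
  rw [h]
  simp [coinEquiv, Fin.appendEquiv]

theorem getD_coinEquiv_rest {N T J : ℕ} (xs : Fin T → Fin N → Bool) (β : Fin J → Bool)
    (j : Fin J) :
    (List.ofFn (coinEquiv N T J (xs, β))).getD (N * T + (j : ℕ)) false = β j := by
  have h := List.getD_ofFn (coinEquiv N T J (xs, β)) false (Fin.natAdd (T * N) j)
  simp only [Fin.val_natAdd] at h
  rw [mul_comm N T, h]
  simp [coinEquiv, Fin.appendEquiv]

theorem sum_bits {R : Type*} [AddCommMonoid R] (J : ℕ) (f : (Fin J → Bool) → R) :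
    ∑ β, f β = ∑ B ∈ Finset.range (2 ^ J), f fun j => B.testBit j := by
  have hinj : Set.InjOn (fun (B : ℕ) (j : Fin J) => B.testBit j) (Finset.range (2 ^ J)) := by
    intro a ha b hb h
    simp only [Finset.coe_range, Set.mem_Iio] at ha hb
    refine Nat.eq_of_testBit_eq fun j => ?_
    by_cases hj : j < J
    · exact congrFun h ⟨j, hj⟩
    · rw [Nat.testBit_eq_false_of_lt (ha.trans_le (Nat.pow_le_pow_right two_pos (by omega))),
        Nat.testBit_eq_false_of_lt (hb.trans_le (Nat.pow_le_pow_right two_pos (by omega)))]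
  have himg : (Finset.range (2 ^ J)).image (fun (B : ℕ) (j : Fin J) => B.testBit j) =
      Finset.univ := by
    rw [← Finset.card_eq_iff_eq_univ, Finset.card_image_of_injOn hinj]
    simp
  rw [← himg, Finset.sum_image hinj]

/-- The result of the algorithm with the random string `ρ`. -/
def sampleOutput {N : ℕ} (C : RevCircuit N) (M : Finset (Fin N)) (T J : ℕ) {m : ℕ}
    (ρ : Fin m → Bool) : M → Bool :=
  assignment M (selected C.encode N (encodeSet M) (List.ofFn ρ) T J (2 ^ M.card))

theorem sum_numberedWeight {N : ℕ} {l : Fin N} (C : RevCircuit N) (M : Finset (Fin N))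
    (x : Fin N → Bool) :
    ∑ z ∈ Finset.range (2 ^ M.card), numberedWeight C.perm l M x z =
      ((2 ^ (M.erase l).card : ℕ) : ℤ) := by
  unfold numberedWeight
  rw [sum_assignment M (fun ζ => quasiWeight C.perm l M (Function.update x l false) ζ),
    sum_quasiWeight _ _ _ _ (by simp)]
  push_cast
  rfl

theorem cumWeight_pos {N : ℕ} {l : Fin N} (hl : (l : ℕ) + 1 = N) (C : RevCircuit N)
    (M : Finset (Fin N)) {T J : ℕ} (hT : 0 < T) {m : ℕ} (hm : m = T * N + J) (ρ : Fin m → Bool) :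
    0 < cumWeight C.encode N (encodeSet M) (List.ofFn ρ) T (2 ^ M.card) (2 ^ M.card) := by
  subst hm
  obtain ⟨⟨xs, β⟩, rfl⟩ := (coinEquiv N T J).surjective ρ
  rw [cumWeight, weight_encode hl C M _ xs (getD_coinEquiv_block xs β)]
  exact (by positivity : 0 < T * 2 ^ (M.erase l).card).trans_le
    (le_sum_sampleWeight (sum_numberedWeight C M) xs)

/-- The coins split bijectively into k² independent inputs and a uniform number below 2^J, so this
is `sampling_error` in terms of assignment numbers. -/
theorem sampleOutput_error {N : ℕ} {l : Fin N} (hl : (l : ℕ) + 1 = N) (C : RevCircuit N)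
    (M : Finset (Fin N)) {k J : ℕ} (hk : 0 < k) {m : ℕ} (hm : m = k ^ 2 * N + J) :
    ∑ ζ : M → Bool, |hc1qProb C M ζ -
        coinProb (fun ρ : Fin m → Bool => sampleOutput C M (k ^ 2) J ρ) ζ| ≤
      6 * (2 ^ M.card : ℕ) / k +
        (2 ^ M.card : ℕ) * (k ^ 2 * (2 ^ (M.erase l).card : ℕ)) / (2 ^ J : ℕ) := by
  subst hm
  have herr := sampling_error (X := Fin N → Bool) (F := numberedWeight C.perm l M)
    (K := 2 ^ M.card) (R := 2 ^ (M.erase l).card) (by positivity) (sum_numberedWeight C M)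
    (fun x z => by
      push_cast
      exact abs_quasiWeight_le _ _ _ _ _)
    (fun z => hc1qProb C M (assignment M z))
    (fun z => by
      rw [hc1qProb_eq hl]
      simp [numberedWeight])
    (fun z => hc1qProb_nonneg _ _ _) (k := k) (Q := 2 ^ J) hk (by positivity)
  refine le_trans (le_of_eq ?_) herr
  rw [← sum_assignment]
  refine Finset.sum_congr rfl fun z hz => ?_
  congr 2
  have hsel : ∀ (xs : Fin (k ^ 2) → Fin N → Bool), ∀ B ∈ Finset.range (2 ^ J),
      selected C.encode N (encodeSet M)
        (List.ofFn (coinEquiv N (k ^ 2) J (xs, fun j => B.testBit j))) (k ^ 2) J (2 ^ M.card) =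
      selectIndex (sampleWeight (numberedWeight C.perm l M) xs) (2 ^ M.card)
        (B % ∑ y ∈ Finset.range (2 ^ M.card), sampleWeight (numberedWeight C.perm l M) xs y) := by
    intro xs B hB
    have hpos := cumWeight_pos hl C M (T := k ^ 2) (J := J) (by positivity) rfl
      (coinEquiv N (k ^ 2) J (xs, fun j => B.testBit j))
    have hd := digitsMod_eq (List.ofFn (coinEquiv N (k ^ 2) J (xs, fun j => B.testBit j)))
      (N * k ^ 2) J hpos (Finset.mem_range.mp hB)
      (fun j hj => getD_coinEquiv_rest xs (fun j => B.testBit j) ⟨j, hj⟩) le_rfl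
    rw [Nat.sub_self, pow_zero, Nat.div_one] at hd
    rw [selected, hd]
    simp only [cumWeight, weight_encode hl C M _ xs (getD_coinEquiv_block xs _)]
    rfl
  have hlt : ∀ (xs : Fin (k ^ 2) → Fin N → Bool) (B : ℕ),
      selectIndex (sampleWeight (numberedWeight C.perm l M) xs) (2 ^ M.card)
        (B % ∑ y ∈ Finset.range (2 ^ M.card), sampleWeight (numberedWeight C.perm l M) xs y) ∈
          (Finset.range (2 ^ M.card) : Set ℕ) := by
    intro xs B
    rw [Finset.mem_coe, Finset.mem_range]
    refine selectIndex_lt (Nat.mod_lt _ ?_)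
    exact (by positivity : 0 < k ^ 2 * 2 ^ (M.erase l).card).trans_le
      (le_sum_sampleWeight (sum_numberedWeight C M) xs)
  have hcount : (Finset.univ.filter fun ρ : Fin (k ^ 2 * N + J) → Bool =>
      sampleOutput C M (k ^ 2) J ρ = assignment M z).card =
      ∑ xs : Fin (k ^ 2) → Fin N → Bool, ((Finset.range (2 ^ J)).filter fun B =>
        selectIndex (sampleWeight (numberedWeight C.perm l M) xs) (2 ^ M.card)
        (B % ∑ y ∈ Finset.range (2 ^ M.card), sampleWeight (numberedWeight C.perm l M) xs y) =
          z).card := by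
    rw [Finset.card_filter, ← (coinEquiv N (k ^ 2) J).sum_comp, Fintype.sum_prod_type]
    refine Finset.sum_congr rfl fun xs _ => ?_
    rw [sum_bits, Finset.card_filter]
    refine Finset.sum_congr rfl fun B hB => ?_
    rw [sampleOutput, hsel xs B hB]
    simp only [(assignment_injOn M).eq_iff (hlt xs B) (Finset.mem_coe.mpr hz)]
  rw [coinProb, hcount, ← Finset.sum_div, div_div]
  push_cast
  congr 1
  simp only [Fintype.card_fun, Fintype.card_fin, Fintype.card_bool]
  push_cast
  rw [pow_add, mul_comm (k ^ 2) N, pow_mul, mul_comm]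

/-- Sets of logarithmic size have polynomially many subsets. -/
theorem exists_two_pow_card_le {k : ℕ → ℕ}
    (hk : (fun n : ℕ => (k n : ℝ)) =O[atTop] (fun n : ℕ => Real.log (n : ℝ))) :
    ∃ p : Polynomial ℕ, ∀ n, 1 ≤ n → ∀ M : Finset (Fin n), M.card ≤ k n →
      2 ^ M.card ≤ p.eval n := by
  obtain ⟨c, hc⟩ := hk.bound
  obtain ⟨n₀, hn₀⟩ := eventually_atTop.mp hc
  -- The power uses 2 ≤ e, hence 2^|M| ≤ exp(c log n), for n at least n₀. The constant covers
  -- smaller n, where |M| ≤ n < n₀.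
  refine ⟨Polynomial.X ^ ⌈c⌉₊ + Polynomial.C (2 ^ n₀), fun n hn M hM => ?_⟩
  simp only [Polynomial.eval_add, Polynomial.eval_pow, Polynomial.eval_X, Polynomial.eval_C]
  by_cases h : n₀ ≤ n
  · have hlog : 0 ≤ Real.log n := Real.log_natCast_nonneg n
    have h₁ := hn₀ n h
    rw [Real.norm_natCast, Real.norm_of_nonneg hlog] at h₁
    have h₂ : (M.card : ℝ) ≤ ⌈c⌉₊ * Real.log n :=
      (Nat.cast_le.mpr hM).trans (h₁.trans (mul_le_mul_of_nonneg_right (Nat.le_ceil c) hlog))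
    have h₃ : (2 : ℝ) ^ M.card ≤ n ^ ⌈c⌉₊ := by
      calc (2 : ℝ) ^ M.card ≤ Real.exp 1 ^ M.card := by
            gcongr
            linarith [Real.add_one_le_exp 1]
        _ = Real.exp M.card := by rw [← Real.exp_nat_mul, mul_one]
        _ ≤ Real.exp (⌈c⌉₊ * Real.log n) := Real.exp_le_exp.mpr h₂
        _ = n ^ ⌈c⌉₊ := by rw [Real.exp_nat_mul, Real.exp_log (by exact_mod_cast hn)]
    have h₄ : 2 ^ M.card ≤ n ^ ⌈c⌉₊ := by exact_mod_cast h₃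
    exact h₄.trans (Nat.le_add_right _ _)
  · have : M.card ≤ n := by simpa using Finset.card_le_univ M
    exact (Nat.pow_le_pow_right two_pos (by omega)).trans (Nat.le_add_left _ _)

/-! ### Choice of parameters and proof of the theorem. -/

theorem theorem3 {ι : Type*} (code : ι → List Bool) (N : ι → ℕ) (hN : ∀ i, 1 ≤ N i)
    (C : ∀ i, RevCircuit (N i)) (hC : UniformlyGenerated code N C)
    (k : ℕ → ℕ) (hk : (fun n : ℕ => (k n : ℝ)) =O[atTop] (fun n : ℕ => Real.log (n : ℝ)))
    (r : Polynomial ℕ) (hr : ∀ n : ℕ, 1 ≤ n → 0 < r.eval n) :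
    ∃ (sampler : Cmd) (m t : Polynomial ℕ),
      ∀ (i : ι) (M : Finset (Fin (N i))), M.card ≤ k (N i) →
        ∃ out : (Fin (m.eval ((code i).length + N i)) → Bool) → (M → Bool),
          (∀ ρ, sampler.OutputsIn [code i, encodeSet M, List.ofFn ρ] (encodeResult (out ρ))
            (t.eval ((code i).length + N i))) ∧
          ∑ z : M → Bool, |hc1qProb (C i) M z - coinProb out z| ≤ 1 / ((r.eval (N i) : ℕ) : ℝ) := by
  obtain ⟨gen, tgen, hgen⟩ := hC
  obtain ⟨κ, hκ⟩ := exists_two_pow_card_le hk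
  -- With q² samples and at most κ outcomes, the statistical error 6κ/q is half of 1/r.
  let q : Polynomial ℕ := 12 * κ * r
  -- The first summand pays for the q² input blocks. The second leaves J ≥ 2rκq²κ coins for the
  -- selection; since J < 2^J, this makes the rounding error at most 1/(2r).
  let m : Polynomial ℕ := q ^ 2 * Polynomial.X + 2 * r * κ * q ^ 2 * κ
  -- An instance includes its coins, so that a single program handles circuits, sets and random
  -- strings uniformly.
  let A := Σ i : ι, {M : Finset (Fin (N i)) // M.card ≤ k (N i)} ×
    (Fin (m.eval ((code i).length + N i)) → Bool)
  let sz : A → ℕ := fun a => (code a.1).length + N a.1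
  let T : A → ℕ := fun a => q.eval (sz a) ^ 2
  let J : A → ℕ := fun a => m.eval (sz a) - N a.1 * T a
  have hmJ : ∀ a, m.eval (sz a) = T a * N a.1 + J a ∧
      2 * r.eval (sz a) * κ.eval (sz a) * T a * κ.eval (sz a) ≤ J a := by
    intro a
    have h₁ : m.eval (sz a) = T a * sz a +
        2 * r.eval (sz a) * κ.eval (sz a) * T a * κ.eval (sz a) := by
      simp [m, T]
    have h₂ : T a * N a.1 ≤ T a * sz a := Nat.mul_le_mul_left _ (by simp [sz])
    have h₃ : J a = m.eval (sz a) - T a * N a.1 := by rw [mul_comm]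
    omega
  have hκ₁ : ∀ a : A, 1 ≤ κ.eval (sz a) := fun a =>
    (by simpa using hκ (N a.1) (hN a.1) ∅ (by simp) : 1 ≤ κ.eval (N a.1)).trans
      (κ.eval_nat_mono (by simp [sz]))
  have hr₁ : ∀ a : A, r.eval (N a.1) ≤ r.eval (sz a) := fun a => r.eval_nat_mono (by simp [sz])
  have hq : ∀ a : A, q.eval (sz a) = 12 * κ.eval (sz a) * r.eval (sz a) := fun a => by simp [q]
  have hq₀ : ∀ a : A, 0 < q.eval (sz a) := fun a => by
    rw [hq]
    exact Nat.mul_pos (by have := hκ₁ a; omega) ((hr _ (hN a.1)).trans_le (hr₁ a))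
  have hlast : ∀ i, (((⟨N i - 1, by have := hN i; omega⟩ : Fin (N i)) : ℕ) + 1 = N i) := fun i => by
    have := hN i; dsimp only; omega
  let inputs : A → List (List Bool) := fun a => [code a.1, encodeSet a.2.1.1, List.ofFn a.2.2]
  let V : Set (A → List Bool) := {v | ∃ r ≤ 2, ∀ a, v a = (inputs a).getD r []}
  have hcode : PT sz V (fun a => code a.1) :=
    .var ⟨0, by omega, fun a => rfl⟩ (PolyBdd.size.mono fun a => by simp [sz])
  have hM : PT sz V (fun a => encodeSet a.2.1.1) :=
    .var ⟨1, by omega, fun a => rfl⟩ (PolyBdd.size.mono fun a => by simp [sz, encodeSet])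
  have hρ : PT sz V (fun a => List.ofFn a.2.2) :=
    .var ⟨2, by omega, fun a => rfl⟩ ((PolyBdd.size.eval m).mono fun a => by simp [sz])
  have hdesc : PT sz V (fun a => (C a.1).encode) := hcode.call gen tgen fun a => hgen a.1
  -- The number of wires is read off from the length of the encoding of M.
  have hn : PTN sz V (fun a => N a.1) := (PTN.length hM).congr fun a => by simp [encodeSet]
  have hsz : PTN sz V sz := (PTN.length hcode).add hn
  have hT : PTN sz V T := (hsz.eval q).pow 2
  have hJ : PTN sz V J := (hsz.eval m).sub (hn.mul hT)
  have hcard : PTN sz V (fun a => a.2.1.1.card) :=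
    (PTN.rank hM hn).congr fun a => rank_encodeSet _
  have hK : PTN sz V (fun a => 2 ^ a.2.1.1.card) :=
    hcard.two_pow ((PolyBdd.size.eval κ).mono fun a =>
      (hκ _ (hN a.1) _ a.2.1.2).trans (κ.eval_nat_mono (by simp [sz])))
  have hsel := PTN.selected hdesc hn hM hρ hT hJ hK fun a =>
    cumWeight_pos (hlast a.1) _ _ (by have := hq₀ a; positivity) (hmJ a).1 _
  have hout := (PT.testBits hsel hcard).congr fun a => (encodeResult_assignment _ _).symm
  obtain ⟨sampler, t, hs⟩ := PT.exists_outputsIn inputs 2 (fun a => by simp [inputs])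
    (PolyBdd.size.mono fun a => by simp [inputs, sz]) hout
  refine ⟨sampler, m, t, fun i M hMk => ?_⟩
  -- T and J depend only on sizes, so any coins serve to name their values.
  let a₀ : A := ⟨i, ⟨M, hMk⟩, fun _ => false⟩
  refine ⟨fun ρ => sampleOutput (C i) M (T a₀) (J a₀) ρ, fun ρ => hs ⟨i, ⟨M, hMk⟩, ρ⟩, ?_⟩
  refine (sampleOutput_error (hlast i) (C i) M (hq₀ a₀) (hmJ a₀).1).trans ?_
  have hK₁ : 2 ^ M.card ≤ κ.eval (sz a₀) :=
    (hκ _ (hN i) _ hMk).trans (κ.eval_nat_mono (by simp [sz, a₀]))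
  have hR₁ : 2 ^ (M.erase ⟨N i - 1, by have := hN i; omega⟩).card ≤ κ.eval (sz a₀) :=
    (Nat.pow_le_pow_right two_pos (Finset.card_le_card (Finset.erase_subset _ _))).trans hK₁
  have hJ₁ : 2 * r.eval (sz a₀) * κ.eval (sz a₀) * T a₀ * κ.eval (sz a₀) ≤ 2 ^ J a₀ :=
    (hmJ a₀).2.trans Nat.lt_two_pow_self.le
  have hrN : (0 : ℝ) < r.eval (N i) := by exact_mod_cast hr _ (hN i)
  have hrL : ((r.eval (N i) : ℕ) : ℝ) ≤ r.eval (sz a₀) := by exact_mod_cast hr₁ a₀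
  have hκ0 : (0 : ℝ) < κ.eval (sz a₀) := by exact_mod_cast hκ₁ a₀
  have hqR : ((q.eval (sz a₀) : ℕ) : ℝ) = 12 * κ.eval (sz a₀) * r.eval (sz a₀) := by
    exact_mod_cast hq a₀
  have hKR : ((2 ^ M.card : ℕ) : ℝ) ≤ κ.eval (sz a₀) := by exact_mod_cast hK₁
  have hRR : ((2 ^ (M.erase ⟨N i - 1, by have := hN i; omega⟩).card : ℕ) : ℝ) ≤
    κ.eval (sz a₀) := by exact_mod_cast hR₁
  have hJR : 2 * ((r.eval (sz a₀) : ℕ) : ℝ) * κ.eval (sz a₀) * ((q.eval (sz a₀) : ℕ) : ℝ) ^ 2 *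
      κ.eval (sz a₀) ≤ (2 ^ J a₀ : ℕ) := by exact_mod_cast hJ₁
  have hR0 : (0 : ℝ) ≤ (2 ^ (M.erase ⟨N i - 1, by have := hN i; omega⟩).card : ℕ) :=
    Nat.cast_nonneg _
  generalize ((2 ^ M.card : ℕ) : ℝ) = K at *
  generalize ((2 ^ (M.erase ⟨N i - 1, by have := hN i; omega⟩).card : ℕ) : ℝ) = R at *
  have hP : (0 : ℝ) < (2 ^ J a₀ : ℕ) := by positivity
  have hr0 : (0 : ℝ) < r.eval (sz a₀) := hrN.trans_le hrL
  have e₁ : 6 * K / ((q.eval (sz a₀) : ℕ) : ℝ) ≤ 1 / (2 * r.eval (N i)) := by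
    rw [hqR, div_le_div_iff₀ (by positivity) (by positivity)]
    nlinarith [mul_le_mul hKR hrL hrN.le hκ0.le]
  have e₂ : K * (((q.eval (sz a₀) : ℕ) : ℝ) ^ 2 * R) / (2 ^ J a₀ : ℕ) ≤
      1 / (2 * r.eval (N i)) := by
    rw [div_le_div_iff₀ hP (by positivity), one_mul]
    refine le_trans ?_ hJR
    calc K * (((q.eval (sz a₀) : ℕ) : ℝ) ^ 2 * R) * (2 * r.eval (N i))
        ≤ κ.eval (sz a₀) * (((q.eval (sz a₀) : ℕ) : ℝ) ^ 2 * κ.eval (sz a₀)) *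
          (2 * r.eval (sz a₀)) := by gcongr
      _ = _ := by ring
  calc _ ≤ 1 / (2 * ((r.eval (N i) : ℕ) : ℝ)) + 1 / (2 * ((r.eval (N i) : ℕ) : ℝ)) :=
        add_le_add e₁ e₂
    _ = _ := by field_simp; norm_num
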